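/- Let $K$ be a field of characteristic $0$. An operad over $K$ is a family of right $K[\Sigma_n]$-modules $\mathcal O(n)$, with $\mathcal O(0)=0$ and $\mathcal O(1)=K\cdot\mathrm{id}$ one-dimensional, together with a unit $\mathrm{id}\in\mathcal O(1)$ and bilinear partial compositions $\circ_i:\mathcal O(n)\otimes\mathcal O(m)\to\mathcal O(n+m-1)$, $1\le i\le n$, satisfying the usual (sequential and parallel) associativity, unit and equivariance axioms. An $n$-labeled rooted tree is a tree with vertex set $\{1,\dots,n\}$ and a distinguished vertex, the root; edges are oriented towards the root. Let $\mathcal T$ be the operad for which $\mathcal T(n)$ is the $K$-vector space spanned by the $n$-labeled rooted trees, with $\Sigma_n$ acting on the labels, and for which $T\circ_i S$ is the tree obtained by substituting the tree $S$ for the vertex $i$ of $T$: the outgoing edge of $i$, if it exists, becomes the outgoing edge of the root of $S$, the incoming edges of $i$ are grafted on the root of $S$, and the labels are renumbered in the way that is standard for $\circ_i$ (label $a$ of $S$ becomes $i+a-1$; label $j$ of $T$ stays $j$ if $j<i$ and becomes $j+m-1$ if $j>i$, where $S$ has $m$ vertices). Let $\mathcal{NAP}=\mathrm{Free}(K[\Sigma_2])/\langle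 R\rangle$ be the quadratic operad governing nonassociative permutative algebras, that is, vector spaces with a bilinear product such that $(ab)c=(ac)b$. Here $\mathrm{Free}(K[\Sigma_2])$ is the free operad generated by the regular representation of $\Sigma_2$ placed in arity $2$, $\mu$ is the generator of $K[\Sigma_2]$, $R$ is the sub-$\Sigma_3$-module of $\mathrm{Free}(K[\Sigma_2])(3)$ generated by $(\mu\circ_1\mu)\cdot(\mathrm{Id}-\tau_{23})$ with $\tau_{23}$ the transposition of $2$ and $3$, and $\langle R\rangle$ is the operadic ideal generated by $R$. Then $\mathcal T$ and $\mathcal{NAP}$ are operads in the above sense, and there is an isomorphism of operads $\mathcal{NAP}\to\mathcal T$ that sends the class of $\mu$ to the tree with two vertices whose root is labeled $1$ (and whose other vertex is labeled $2$). -/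

import Mathlib

universe u

noncomputable section

namespace SymOperad

/-! ## Symmetric operads over a field, in partial-composition form

The inputs of an operation of arity `n` are numbered by `Fin n`, that is `0, …, n-1`
instead of `1, …, n`. -/

/-- A `Σ`-module: for each `n` a `K`-module with a right action of the symmetric group on `n`
letters; `act σ x` is `x · σ`, and `σ * τ` is `σ ∘ τ`. -/
structure SigmaModule (K : Type u) [Field K] where
  obj : ℕ → Type u
  [addCommGroup : ∀ n, AddCommGroup (obj n)]
  [module : ∀ n, Module K (obj n)]
  act : ∀ {n : ℕ}, Equiv.Perm (Fin n) → (obj n →ₗ[K] obj n)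
  act_one : ∀ {n : ℕ} (x : obj n), act 1 x = x
  act_mul : ∀ {n : ℕ} (σ τ : Equiv.Perm (Fin n)) (x : obj n), act (σ * τ) x = act τ (act σ x)

attribute [instance] SigmaModule.addCommGroup SigmaModule.module

/-- A morphism of `Σ`-modules: an equivariant linear map in each arity. -/
structure SigmaModule.Hom {K : Type u} [Field K] (M N : SigmaModule K) where
  map : ∀ n : ℕ, M.obj n →ₗ[K] N.obj n
  map_act : ∀ {n : ℕ} (σ : Equiv.Perm (Fin n)) (x : M.obj n),
    map n (M.act σ x) = N.act σ (map n x)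

/-! ### Numbering of the inputs of `p ∘_i q`

For `p` of arity `n` and `q` of arity `m`, the arity of `p ∘_i q` is the number `k = n + m - 1`;
it is written as `k + 1 = n + m`. Input `a` of `q` becomes input `i + a`; input `j ≠ i` of `p`
becomes input `j` if `j < i`, and input `j + m - 1` if `j > i`. -/

/-- The number in `p ∘_i q` of the input `a` of `q`. -/
def inner {n m k : ℕ} (h : k + 1 = n + m) (i : Fin n) (a : Fin m) : Fin k :=
  ⟨i + a, by omega⟩

/-- The number in `p ∘_i q` of the input `j ≠ i` of `p`. -/
def outer {n m k : ℕ} (h : k + 1 = n + m) (i j : Fin n) (hj : j ≠ i) : Fin k :=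
  ⟨if j < i then (j : ℕ) else j + m - 1, by
    have hj' : (j : ℕ) ≠ i := fun e => hj (Fin.ext e)
    split_ifs with hlt
    · have : (j : ℕ) < i := hlt
      omega
    · have : ¬ (j : ℕ) < i := hlt
      omega⟩

lemma inner_val {n m k : ℕ} (h : k + 1 = n + m) (i : Fin n) (a : Fin m) :
    (inner h i a : ℕ) = i + a := rfl

lemma outer_val {n m k : ℕ} (h : k + 1 = n + m) (i j : Fin n) (hj : j ≠ i) :
    (outer h i j hj : ℕ) = if (j : ℕ) < i then (j : ℕ) else j + m - 1 := rfl

lemma inner_injective {n m k : ℕ} (h : k + 1 = n + m) (i : Fin n) :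
    Function.Injective (inner h i) := by
  intro a b hab
  have := congrArg Fin.val hab
  simp only [inner_val] at this
  exact Fin.ext (by omega)

lemma outer_ne_inner {n m k : ℕ} (h : k + 1 = n + m) (i j : Fin n) (hj : j ≠ i) (a : Fin m) :
    outer h i j hj ≠ inner h i a := by
  intro hab
  have := congrArg Fin.val hab
  have hj' : (j : ℕ) ≠ i := fun e => hj (Fin.ext e)
  simp only [inner_val, outer_val] at this
  split_ifs at this <;> omega

lemma outer_inj {n m k : ℕ} (h : k + 1 = n + m) (i j j' : Fin n) (hj : j ≠ i) (hj' : j' ≠ i)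
    (e : outer h i j hj = outer h i j' hj') : j = j' := by
  have := congrArg Fin.val e
  have h1 : (j : ℕ) ≠ i := fun e => hj (Fin.ext e)
  have h2 : (j' : ℕ) ≠ i := fun e => hj' (Fin.ext e)
  simp only [outer_val] at this
  apply Fin.ext
  split_ifs at this <;> omega

lemma eq_inner_or_outer {n m k : ℕ} (h : k + 1 = n + m) (i : Fin n) (x : Fin k) :
    (∃ a, x = inner h i a) ∨ ∃ j, ∃ hj : j ≠ i, x = outer h i j hj := by
  by_cases h1 : (x : ℕ) < i
  · right
    refine ⟨⟨x, by omega⟩, fun e => ?_, Fin.ext ?_⟩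
    · have := congrArg Fin.val e
      simp only at this
      omega
    · simp [outer_val, h1]
  · by_cases h2 : (x : ℕ) < i + m
    · left
      exact ⟨⟨x - i, by omega⟩, Fin.ext (by simp only [inner_val]; omega)⟩
    · right
      refine ⟨⟨x + 1 - m, by omega⟩, fun e => ?_, Fin.ext ?_⟩
      · have := congrArg Fin.val e
        simp only at this
        omega
      · simp only [outer_val]
        split_ifs <;> omega

/-- The inputs of `p ∘_i q` are those of `p` other than `i`, together with those of `q`. -/
def blockEquiv {n m k : ℕ} (h : k + 1 = n + m) (i : Fin n) :
    {j : Fin n // j ≠ i} ⊕ Fin m ≃ Fin k :=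
  Equiv.ofBijective (Sum.elim (fun j => outer h i j.1 j.2) (inner h i)) (by
    constructor
    · rintro (⟨j, hj⟩ | a) (⟨j', hj'⟩ | b) e
      · simp only [Sum.elim_inl] at e
        simp only [Sum.inl.injEq, Subtype.mk.injEq]
        exact outer_inj h i j j' hj hj' e
      · exact absurd e (outer_ne_inner h i j hj b)
      · exact absurd e.symm (outer_ne_inner h i j' hj' a)
      · exact congrArg Sum.inr (inner_injective h i e)
    · intro x
      rcases eq_inner_or_outer h i x with ⟨a, rfl⟩ | ⟨j, hj, rfl⟩
      · exact ⟨Sum.inr a, rfl⟩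
      · exact ⟨Sum.inl ⟨j, hj⟩, rfl⟩)

/-- The permutation `σ ∘_i τ` of the inputs of a composite: it sends input `a` of the inner
operation (inserted at `i`) to input `τ a` of the inner operation (inserted at `σ i`), and input
`j ≠ i` of the outer operation to input `σ j` of the outer operation. -/
def compPerm {n m k : ℕ} (h : k + 1 = n + m) (i : Fin n) (σ : Equiv.Perm (Fin n))
    (τ : Equiv.Perm (Fin m)) : Equiv.Perm (Fin k) :=
  (blockEquiv h i).symm.trans
    ((Equiv.sumCongr (σ.subtypeEquiv (fun _ => by simp)) τ).trans (blockEquiv h (σ i)))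

lemma compPerm_inner {n m k : ℕ} (h : k + 1 = n + m) (i : Fin n) (σ : Equiv.Perm (Fin n))
    (τ : Equiv.Perm (Fin m)) (a : Fin m) :
    compPerm h i σ τ (inner h i a) = inner h (σ i) (τ a) := by
  have : inner h i a = blockEquiv h i (Sum.inr a) := rfl
  rw [this, compPerm, Equiv.trans_apply, Equiv.symm_apply_apply]
  rfl

lemma compPerm_outer {n m k : ℕ} (h : k + 1 = n + m) (i : Fin n) (σ : Equiv.Perm (Fin n))
    (τ : Equiv.Perm (Fin m)) (j : Fin n) (hj : j ≠ i) :
    compPerm h i σ τ (outer h i j hj) = outer h (σ i) (σ j) (σ.injective.ne hj) := by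
  have : outer h i j hj = blockEquiv h i (Sum.inl ⟨j, hj⟩) := rfl
  rw [this, compPerm, Equiv.trans_apply, Equiv.symm_apply_apply]
  rfl

/-- A (`K`-linear, symmetric, unital) operad: `comp h i p q` is `p ∘_i q`. The axioms are the
sequential and the parallel associativity condition, the two unit conditions, and equivariance. -/
structure Operad (K : Type u) [Field K] extends SigmaModule K where
  one : obj 1
  comp : ∀ {n m k : ℕ}, k + 1 = n + m → Fin n → (obj n →ₗ[K] obj m →ₗ[K] obj k)
  one_comp : ∀ {n : ℕ} (h : n + 1 = 1 + n) (p : obj n), comp h 0 one p = p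
  comp_one : ∀ {n : ℕ} (h : n + 1 = n + 1) (i : Fin n) (p : obj n), comp h i p one = p
  comp_assoc : ∀ {n m l a b k : ℕ} (h₁ : a + 1 = n + m) (h₂ : k + 1 = a + l)
    (h₃ : b + 1 = m + l) (h₄ : k + 1 = n + b) (i : Fin n) (j : Fin m)
    (p : obj n) (q : obj m) (r : obj l),
    comp h₂ (inner h₁ i j) (comp h₁ i p q) r = comp h₄ i p (comp h₃ j q r)
  comp_comm : ∀ {n m l a b k : ℕ} (h₁ : a + 1 = n + m) (h₂ : k + 1 = a + l)
    (h₃ : b + 1 = n + l) (h₄ : k + 1 = b + m) (i j : Fin n) (hij : i ≠ j)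
    (p : obj n) (q : obj m) (r : obj l),
    comp h₂ (outer h₁ i j hij.symm) (comp h₁ i p q) r =
      comp h₄ (outer h₃ j i hij) (comp h₃ j p r) q
  comp_act : ∀ {n m k : ℕ} (h : k + 1 = n + m) (i : Fin n) (σ : Equiv.Perm (Fin n))
    (τ : Equiv.Perm (Fin m)) (p : obj n) (q : obj m),
    comp h i (act σ p) (act τ q) = act (compPerm h i σ τ) (comp h (σ i) p q)

namespace Operad

variable {K : Type u} [Field K]

/-- The normalization `O(0) = 0` (that is, only arities `n > 0` occur) and `O(1) = K`. -/
def IsNormalized (P : Operad K) : Prop :=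
  Subsingleton (P.obj 0) ∧ Function.Bijective (fun c : K => c • P.one)

/-- A morphism of operads. -/
structure Hom (P Q : Operad K) extends SigmaModule.Hom P.toSigmaModule Q.toSigmaModule where
  map_one : map 1 P.one = Q.one
  map_comp : ∀ {n m k : ℕ} (h : k + 1 = n + m) (i : Fin n) (p : P.obj n) (q : P.obj m),
    map k (P.comp h i p q) = Q.comp h i (map n p) (map m q)

/-- An isomorphism of operads: a pair of mutually inverse morphisms of operads. -/
structure Iso (P Q : Operad K) where
  hom : Hom P Q
  inv : Hom Q P
  inv_hom : ∀ (n : ℕ) (p : P.obj n), inv.map n (hom.map n p) = p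
  hom_inv : ∀ (n : ℕ) (q : Q.obj n), hom.map n (inv.map n q) = q

/-! ### Ideals and quotients -/

/-- An ideal of an operad: a family of subspaces that is stable under the symmetric groups and
under composition with arbitrary operations on either side. -/
structure Ideal (P : Operad K) where
  carrier : ∀ n : ℕ, Submodule K (P.obj n)
  act_mem : ∀ {n : ℕ} (σ : Equiv.Perm (Fin n)) {x : P.obj n},
    x ∈ carrier n → P.act σ x ∈ carrier n
  comp_mem_left : ∀ {n m k : ℕ} (h : k + 1 = n + m) (i : Fin n) {p : P.obj n} (q : P.obj m),
    p ∈ carrier n → P.comp h i p q ∈ carrier k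
  comp_mem_right : ∀ {n m k : ℕ} (h : k + 1 = n + m) (i : Fin n) (p : P.obj n) {q : P.obj m},
    q ∈ carrier m → P.comp h i p q ∈ carrier k

/-- The ideal generated by a set of operations of arity `d`: the intersection of all ideals
that contain it. -/
def Ideal.span (P : Operad K) {d : ℕ} (R : Set (P.obj d)) : Ideal P where
  carrier n := ⨅ (I : Ideal P) (_ : R ⊆ I.carrier d), I.carrier n
  act_mem σ x hx := by
    simp only [Submodule.mem_iInf] at hx ⊢
    exact fun I hI => I.act_mem σ (hx I hI)
  comp_mem_left h i p q hp := by
    simp only [Submodule.mem_iInf] at hp ⊢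
    exact fun I hI => I.comp_mem_left h i q (hp I hI)
  comp_mem_right h i p q hq := by
    simp only [Submodule.mem_iInf] at hq ⊢
    exact fun I hI => I.comp_mem_right h i p (hq I hI)

/-- Composition on the quotient by an ideal. -/
def Ideal.quotComp {P : Operad K} (I : Ideal P) {n m k : ℕ} (h : k + 1 = n + m) (i : Fin n) :
    (P.obj n ⧸ I.carrier n) →ₗ[K] (P.obj m ⧸ I.carrier m) →ₗ[K] (P.obj k ⧸ I.carrier k) :=
  (I.carrier n).liftQ
    (LinearMap.mk₂ K
      (fun p q => (I.carrier m).mapQ (I.carrier k) (P.comp h i p)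
        (fun _ hq => I.comp_mem_right h i p hq) q)
      (fun p p' q => by
        induction q using Submodule.Quotient.induction_on
        simp)
      (fun c p q => by
        induction q using Submodule.Quotient.induction_on
        simp)
      (fun p q q' => by simp)
      (fun c p q => by simp))
    (fun p hp => by
      rw [LinearMap.mem_ker]
      ext q
      simp only [LinearMap.coe_comp, Function.comp_apply, Submodule.mkQ_apply,
        LinearMap.mk₂_apply, Submodule.mapQ_apply, LinearMap.zero_apply]
      exact (Submodule.Quotient.mk_eq_zero _).2 (I.comp_mem_left h i q hp))

lemma Ideal.quotComp_mk {P : Operad K} (I : Ideal P) {n m k : ℕ} (h : k + 1 = n + m) (i : Fin n)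
    (p : P.obj n) (q : P.obj m) :
    I.quotComp h i (Submodule.Quotient.mk p) (Submodule.Quotient.mk q) =
      Submodule.Quotient.mk (P.comp h i p q) := rfl

/-- The quotient of an operad by an ideal. -/
def quotient (P : Operad K) (I : Ideal P) : Operad K where
  obj n := P.obj n ⧸ I.carrier n
  act {n} σ := (I.carrier n).mapQ (I.carrier n) (P.act σ) (fun _ hx => I.act_mem σ hx)
  act_one x := by
    induction x using Submodule.Quotient.induction_on
    simp [P.act_one]
  act_mul σ τ x := by
    induction x using Submodule.Quotient.induction_on
    simp [P.act_mul]
  one := Submodule.Quotient.mk P.one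
  comp h i := I.quotComp h i
  one_comp h p := by
    induction p using Submodule.Quotient.induction_on
    rw [Ideal.quotComp_mk, P.one_comp]
  comp_one h i p := by
    induction p using Submodule.Quotient.induction_on
    rw [Ideal.quotComp_mk, P.comp_one]
  comp_assoc h₁ h₂ h₃ h₄ i j p q r := by
    induction p using Submodule.Quotient.induction_on
    induction q using Submodule.Quotient.induction_on
    induction r using Submodule.Quotient.induction_on
    simp only [Ideal.quotComp_mk]
    rw [P.comp_assoc h₁ h₂ h₃ h₄]
  comp_comm h₁ h₂ h₃ h₄ i j hij p q r := by
    induction p using Submodule.Quotient.induction_on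
    induction q using Submodule.Quotient.induction_on
    induction r using Submodule.Quotient.induction_on
    simp only [Ideal.quotComp_mk]
    rw [P.comp_comm h₁ h₂ h₃ h₄]
  comp_act h i σ τ p q := by
    induction p using Submodule.Quotient.induction_on
    induction q using Submodule.Quotient.induction_on
    simp only [Submodule.mapQ_apply, Ideal.quotComp_mk]
    rw [P.comp_act]

end Operad

/-! ## The free operad generated by a `Σ`-module -/

section Free

variable {K : Type u} [Field K]

/-- Formal expressions in elements of `M`, the unit, permutations of inputs, partial compositions,
and linear combinations, sorted by arity. -/
inductive FreeTerm (M : SigmaModule K) : ℕ → Type u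
  | gen {n : ℕ} (x : M.obj n) : FreeTerm M n
  | one : FreeTerm M 1
  | act {n : ℕ} (σ : Equiv.Perm (Fin n)) (p : FreeTerm M n) : FreeTerm M n
  | comp {n m k : ℕ} (h : k + 1 = n + m) (i : Fin n) (p : FreeTerm M n) (q : FreeTerm M m) :
      FreeTerm M k
  | zero {n : ℕ} : FreeTerm M n
  | add {n : ℕ} (p q : FreeTerm M n) : FreeTerm M n
  | smul {n : ℕ} (c : K) (p : FreeTerm M n) : FreeTerm M n

open FreeTerm in
/-- The congruence generated by the axioms of operads and by the requirement that `gen` be a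
morphism of `Σ`-modules. -/
inductive FreeRel (M : SigmaModule K) : ∀ {n : ℕ}, FreeTerm M n → FreeTerm M n → Prop
  -- equivalence relation
  | refl {n : ℕ} (p : FreeTerm M n) : FreeRel M p p
  | symm {n : ℕ} {p q : FreeTerm M n} : FreeRel M p q → FreeRel M q p
  | trans {n : ℕ} {p q r : FreeTerm M n} : FreeRel M p q → FreeRel M q r → FreeRel M p r
  -- compatibility with the operations
  | congr_act {n : ℕ} (σ : Equiv.Perm (Fin n)) {p q : FreeTerm M n} :
      FreeRel M p q → FreeRel M (act σ p) (act σ q)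
  | congr_comp {n m k : ℕ} (h : k + 1 = n + m) (i : Fin n) {p p' : FreeTerm M n}
      {q q' : FreeTerm M m} :
      FreeRel M p p' → FreeRel M q q' → FreeRel M (comp h i p q) (comp h i p' q')
  | congr_add {n : ℕ} {p p' q q' : FreeTerm M n} :
      FreeRel M p p' → FreeRel M q q' → FreeRel M (add p q) (add p' q')
  | congr_smul {n : ℕ} (c : K) {p q : FreeTerm M n} :
      FreeRel M p q → FreeRel M (smul c p) (smul c q)
  -- vector space axioms
  | add_assoc {n : ℕ} (p q r : FreeTerm M n) : FreeRel M (add (add p q) r) (add p (add q r))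
  | add_comm {n : ℕ} (p q : FreeTerm M n) : FreeRel M (add p q) (add q p)
  | zero_add {n : ℕ} (p : FreeTerm M n) : FreeRel M (add zero p) p
  | zero_smul {n : ℕ} (p : FreeTerm M n) : FreeRel M (smul 0 p) zero
  | one_smul {n : ℕ} (p : FreeTerm M n) : FreeRel M (smul 1 p) p
  | mul_smul {n : ℕ} (c d : K) (p : FreeTerm M n) :
      FreeRel M (smul (c * d) p) (smul c (smul d p))
  | smul_add {n : ℕ} (c : K) (p q : FreeTerm M n) :
      FreeRel M (smul c (add p q)) (add (smul c p) (smul c q))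
  | add_smul {n : ℕ} (c d : K) (p : FreeTerm M n) :
      FreeRel M (smul (c + d) p) (add (smul c p) (smul d p))
  -- linearity of the structure maps
  | act_add {n : ℕ} (σ : Equiv.Perm (Fin n)) (p q : FreeTerm M n) :
      FreeRel M (act σ (add p q)) (add (act σ p) (act σ q))
  | act_smul {n : ℕ} (σ : Equiv.Perm (Fin n)) (c : K) (p : FreeTerm M n) :
      FreeRel M (act σ (smul c p)) (smul c (act σ p))
  | add_comp {n m k : ℕ} (h : k + 1 = n + m) (i : Fin n) (p p' : FreeTerm M n)
      (q : FreeTerm M m) :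
      FreeRel M (comp h i (add p p') q) (add (comp h i p q) (comp h i p' q))
  | smul_comp {n m k : ℕ} (h : k + 1 = n + m) (i : Fin n) (c : K) (p : FreeTerm M n)
      (q : FreeTerm M m) :
      FreeRel M (comp h i (smul c p) q) (smul c (comp h i p q))
  | comp_add {n m k : ℕ} (h : k + 1 = n + m) (i : Fin n) (p : FreeTerm M n)
      (q q' : FreeTerm M m) :
      FreeRel M (comp h i p (add q q')) (add (comp h i p q) (comp h i p q'))
  | comp_smul {n m k : ℕ} (h : k + 1 = n + m) (i : Fin n) (c : K) (p : FreeTerm M n)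
      (q : FreeTerm M m) :
      FreeRel M (comp h i p (smul c q)) (smul c (comp h i p q))
  -- operad axioms
  | act_one {n : ℕ} (p : FreeTerm M n) : FreeRel M (act 1 p) p
  | act_mul {n : ℕ} (σ τ : Equiv.Perm (Fin n)) (p : FreeTerm M n) :
      FreeRel M (act (σ * τ) p) (act τ (act σ p))
  | one_comp {n : ℕ} (h : n + 1 = 1 + n) (p : FreeTerm M n) : FreeRel M (comp h 0 one p) p
  | comp_one {n : ℕ} (h : n + 1 = n + 1) (i : Fin n) (p : FreeTerm M n) :
      FreeRel M (comp h i p one) p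
  | comp_assoc {n m l a b k : ℕ} (h₁ : a + 1 = n + m) (h₂ : k + 1 = a + l)
      (h₃ : b + 1 = m + l) (h₄ : k + 1 = n + b) (i : Fin n) (j : Fin m)
      (p : FreeTerm M n) (q : FreeTerm M m) (r : FreeTerm M l) :
      FreeRel M (comp h₂ (inner h₁ i j) (comp h₁ i p q) r) (comp h₄ i p (comp h₃ j q r))
  | comp_comm {n m l a b k : ℕ} (h₁ : a + 1 = n + m) (h₂ : k + 1 = a + l)
      (h₃ : b + 1 = n + l) (h₄ : k + 1 = b + m) (i j : Fin n) (hij : i ≠ j)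
      (p : FreeTerm M n) (q : FreeTerm M m) (r : FreeTerm M l) :
      FreeRel M (comp h₂ (outer h₁ i j hij.symm) (comp h₁ i p q) r)
        (comp h₄ (outer h₃ j i hij) (comp h₃ j p r) q)
  | comp_act {n m k : ℕ} (h : k + 1 = n + m) (i : Fin n) (σ : Equiv.Perm (Fin n))
      (τ : Equiv.Perm (Fin m)) (p : FreeTerm M n) (q : FreeTerm M m) :
      FreeRel M (comp h i (act σ p) (act τ q)) (act (compPerm h i σ τ) (comp h (σ i) p q))
  -- `gen` is a morphism of `Σ`-modules
  | gen_add {n : ℕ} (x y : M.obj n) : FreeRel M (gen (x + y)) (add (gen x) (gen y))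
  | gen_smul {n : ℕ} (c : K) (x : M.obj n) : FreeRel M (gen (c • x)) (smul c (gen x))
  | gen_act {n : ℕ} (σ : Equiv.Perm (Fin n)) (x : M.obj n) :
      FreeRel M (gen (M.act σ x)) (act σ (gen x))

/-- The equivalence of formal expressions of arity `n`. -/
def freeSetoid (M : SigmaModule K) (n : ℕ) : Setoid (FreeTerm M n) where
  r := FreeRel M
  iseqv := ⟨FreeRel.refl, FreeRel.symm, FreeRel.trans⟩

/-- The underlying sets of the free operad. -/
def FreeObj (M : SigmaModule K) (n : ℕ) : Type u := Quotient (freeSetoid M n)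

namespace FreeObj

variable {M : SigmaModule K}

/-- The class of a formal expression. -/
def mk {n : ℕ} (p : FreeTerm M n) : FreeObj M n := Quotient.mk (freeSetoid M n) p

lemma sound {n : ℕ} {p q : FreeTerm M n} (h : FreeRel M p q) : mk p = mk q := Quotient.sound h

lemma ind {n : ℕ} {motive : FreeObj M n → Prop} (h : ∀ p, motive (mk p)) (x : FreeObj M n) :
    motive x := Quotient.ind h x

instance (n : ℕ) : Zero (FreeObj M n) := ⟨mk .zero⟩

instance (n : ℕ) : Add (FreeObj M n) :=
  ⟨Quotient.map₂ FreeTerm.add (fun _ _ h _ _ h' => FreeRel.congr_add h h')⟩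

instance (n : ℕ) : SMul K (FreeObj M n) :=
  ⟨fun c => Quotient.map (FreeTerm.smul c) (fun _ _ h => FreeRel.congr_smul c h)⟩

lemma mk_add {n : ℕ} (p q : FreeTerm M n) : mk (p.add q) = mk p + mk q := rfl
lemma mk_smul {n : ℕ} (c : K) (p : FreeTerm M n) : mk (p.smul c) = c • mk p := rfl
lemma mk_zero {n : ℕ} : mk (.zero : FreeTerm M n) = 0 := rfl

instance (n : ℕ) : Neg (FreeObj M n) := ⟨fun x => (-1 : K) • x⟩

instance (n : ℕ) : AddCommGroup (FreeObj M n) where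
  add_assoc x y z := by
    induction x using ind; induction y using ind; induction z using ind
    exact sound (.add_assoc _ _ _)
  zero_add x := by
    induction x using ind
    exact sound (.zero_add _)
  add_zero x := by
    induction x using ind
    exact (sound (.add_comm _ _)).trans (sound (.zero_add _))
  add_comm x y := by
    induction x using ind; induction y using ind
    exact sound (.add_comm _ _)
  nsmul := nsmulRec
  zsmul := zsmulRec
  neg_add_cancel x := by
    induction x using ind with
    | h p =>
      have h1 : mk p = (1 : K) • mk p := (sound (.one_smul p)).symm
      have h2 : (-1 : K) • mk p + (1 : K) • mk p = (-1 + 1 : K) • mk p :=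
        (sound (.add_smul _ _ p)).symm
      have h3 : (0 : K) • mk p = 0 := sound (.zero_smul p)
      change (-1 : K) • mk p + mk p = 0
      have h4 : (-1 : K) • mk p + mk p = (-1 : K) • mk p + (1 : K) • mk p := by rw [← h1]
      rw [h4, h2, neg_add_cancel, h3]

instance (n : ℕ) : Module K (FreeObj M n) where
  one_smul x := by
    induction x using ind
    exact sound (.one_smul _)
  mul_smul c d x := by
    induction x using ind
    exact sound (.mul_smul _ _ _)
  smul_zero c := by
    have h3 : ∀ d : K, d • (0 : FreeObj M n) = (d * 0) • (0 : FreeObj M n) := fun d => by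
      have e : (0 : K) • (0 : FreeObj M n) = 0 := sound (.zero_smul _)
      conv_lhs => rw [← e]
      exact (sound (.mul_smul d 0 .zero)).symm
    rw [h3, mul_zero]
    exact sound (.zero_smul _)
  smul_add c x y := by
    induction x using ind; induction y using ind
    exact sound (.smul_add _ _ _)
  add_smul c d x := by
    induction x using ind
    exact sound (.add_smul _ _ _)
  zero_smul x := by
    induction x using ind
    exact sound (.zero_smul _)

end FreeObj

/-- The free operad generated by a `Σ`-module `M`. -/
def freeOperad (M : SigmaModule K) : Operad K where
  obj := FreeObj M
  act σ :=
    { toFun := Quotient.map (FreeTerm.act σ) (fun _ _ h => FreeRel.congr_act σ h)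
      map_add' := fun x y => by
        induction x using FreeObj.ind; induction y using FreeObj.ind
        exact FreeObj.sound (.act_add _ _ _)
      map_smul' := fun c x => by
        induction x using FreeObj.ind
        exact FreeObj.sound (.act_smul _ _ _) }
  act_one x := by
    induction x using FreeObj.ind
    exact FreeObj.sound (.act_one _)
  act_mul σ τ x := by
    induction x using FreeObj.ind
    exact FreeObj.sound (.act_mul _ _ _)
  one := FreeObj.mk .one
  comp h i := LinearMap.mk₂ K
    (Quotient.map₂ (FreeTerm.comp h i) (fun _ _ hp _ _ hq => FreeRel.congr_comp h i hp hq))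
    (fun x x' y => by
      induction x using FreeObj.ind; induction x' using FreeObj.ind
      induction y using FreeObj.ind
      exact FreeObj.sound (.add_comp _ _ _ _ _))
    (fun c x y => by
      induction x using FreeObj.ind; induction y using FreeObj.ind
      exact FreeObj.sound (.smul_comp _ _ _ _ _))
    (fun x y y' => by
      induction x using FreeObj.ind; induction y using FreeObj.ind
      induction y' using FreeObj.ind
      exact FreeObj.sound (.comp_add _ _ _ _ _))
    (fun c x y => by
      induction x using FreeObj.ind; induction y using FreeObj.ind
      exact FreeObj.sound (.comp_smul _ _ _ _ _))
  one_comp h p := by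
    induction p using FreeObj.ind
    exact FreeObj.sound (.one_comp _ _)
  comp_one h i p := by
    induction p using FreeObj.ind
    exact FreeObj.sound (.comp_one _ _ _)
  comp_assoc h₁ h₂ h₃ h₄ i j p q r := by
    induction p using FreeObj.ind; induction q using FreeObj.ind; induction r using FreeObj.ind
    exact FreeObj.sound (.comp_assoc _ _ _ _ _ _ _ _ _)
  comp_comm h₁ h₂ h₃ h₄ i j hij p q r := by
    induction p using FreeObj.ind; induction q using FreeObj.ind; induction r using FreeObj.ind
    exact FreeObj.sound (.comp_comm _ _ _ _ _ _ _ _ _ _)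
  comp_act h i σ τ p q := by
    induction p using FreeObj.ind; induction q using FreeObj.ind
    exact FreeObj.sound (.comp_act _ _ _ _ _ _)

/-- The canonical morphism of `Σ`-modules from `M` to the free operad generated by `M`. -/
def freeOperad.ι (M : SigmaModule K) : SigmaModule.Hom M (freeOperad M).toSigmaModule where
  map _ :=
    { toFun := fun x => FreeObj.mk (.gen x)
      map_add' := fun x y => FreeObj.sound (.gen_add x y)
      map_smul' := fun c x => FreeObj.sound (.gen_smul c x) }
  map_act σ x := FreeObj.sound (.gen_act σ x)

/-- Evaluation of formal expressions in an operad. -/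
def FreeTerm.eval {M : SigmaModule K} {Q : Operad K} (f : SigmaModule.Hom M Q.toSigmaModule) :
    ∀ {n : ℕ}, FreeTerm M n → Q.obj n
  | _, .gen x => f.map _ x
  | _, .one => Q.one
  | _, .act σ p => Q.act σ (p.eval f)
  | _, .comp h i p q => Q.comp h i (p.eval f) (q.eval f)
  | _, .zero => 0
  | _, .add p q => p.eval f + q.eval f
  | _, .smul c p => c • p.eval f

lemma FreeRel.eval_eq {M : SigmaModule K} {Q : Operad K}
    (f : SigmaModule.Hom M Q.toSigmaModule) {n : ℕ} {p q : FreeTerm M n} (h : FreeRel M p q) :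
    p.eval f = q.eval f := by
  induction h with
  | refl => rfl
  | symm _ ih => exact ih.symm
  | trans _ _ ih ih' => exact ih.trans ih'
  | congr_act σ _ ih => simp only [FreeTerm.eval, ih]
  | congr_comp h i _ _ ih ih' => simp only [FreeTerm.eval, ih, ih']
  | congr_add _ _ ih ih' => simp only [FreeTerm.eval, ih, ih']
  | congr_smul c _ ih => simp only [FreeTerm.eval, ih]
  | add_assoc p q r => exact _root_.add_assoc _ _ _
  | add_comm p q => exact _root_.add_comm _ _
  | zero_add p => exact _root_.zero_add _
  | zero_smul p => exact _root_.zero_smul K _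
  | one_smul p => exact _root_.one_smul K _
  | mul_smul c d p => exact SemigroupAction.mul_smul c d _
  | smul_add c p q => exact _root_.smul_add c _ _
  | add_smul c d p => exact _root_.add_smul c d _
  | act_add σ p q => exact map_add _ _ _
  | act_smul σ c p => exact map_smul _ _ _
  | add_comp h i p p' q => simp only [FreeTerm.eval, map_add, LinearMap.add_apply]
  | smul_comp h i c p q => simp only [FreeTerm.eval, map_smul, LinearMap.smul_apply]
  | comp_add h i p q q' => simp only [FreeTerm.eval, map_add]
  | comp_smul h i c p q => simp only [FreeTerm.eval, map_smul]
  | act_one p => exact Q.act_one _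
  | act_mul σ τ p => exact Q.act_mul _ _ _
  | one_comp h p => exact Q.one_comp _ _
  | comp_one h i p => exact Q.comp_one _ _ _
  | comp_assoc h₁ h₂ h₃ h₄ i j p q r => exact Q.comp_assoc h₁ h₂ h₃ h₄ _ _ _ _ _
  | comp_comm h₁ h₂ h₃ h₄ i j hij p q r => exact Q.comp_comm h₁ h₂ h₃ h₄ _ _ hij _ _ _
  | comp_act h i σ τ p q => exact Q.comp_act _ _ _ _ _ _
  | gen_add x y => exact map_add _ _ _
  | gen_smul c x => exact map_smul _ _ _
  | gen_act σ x => exact f.map_act _ _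

/-- The universal property of the free operad. -/
theorem freeOperad.existsUnique_hom (M : SigmaModule K) (Q : Operad K)
    (f : SigmaModule.Hom M Q.toSigmaModule) :
    ∃! F : Operad.Hom (freeOperad M) Q,
      ∀ (n : ℕ) (x : M.obj n), F.map n ((freeOperad.ι M).map n x) = f.map n x := by
  refine ⟨{ map := fun n =>
              { toFun := Quotient.lift (fun p => p.eval f) (fun _ _ h => FreeRel.eval_eq f h)
                map_add' := ?_
                map_smul' := ?_ }
            map_act := ?_
            map_one := rfl
            map_comp := ?_ }, fun n x => rfl, ?_⟩
  · intro x y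
    induction x using FreeObj.ind; induction y using FreeObj.ind
    rfl
  · intro c x
    induction x using FreeObj.ind
    rfl
  · intro n σ x
    induction x using FreeObj.ind
    rfl
  · intro n m k h i x y
    induction x using FreeObj.ind; induction y using FreeObj.ind
    rfl
  · intro G hG
    have key : ∀ (n : ℕ) (p : FreeTerm M n), G.map n (FreeObj.mk p) = p.eval f := by
      intro n p
      induction p with
      | gen x => exact hG _ x
      | one => exact G.map_one
      | act σ p ih =>
        rw [FreeTerm.eval, ← ih]
        exact G.map_act σ (FreeObj.mk p)
      | comp h i p q ih ih' =>
        rw [FreeTerm.eval, ← ih, ← ih']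
        exact G.map_comp h i (FreeObj.mk p) (FreeObj.mk q)
      | zero => exact map_zero (G.map _)
      | add p q ih ih' =>
        rw [FreeTerm.eval, ← ih, ← ih']
        exact map_add (G.map _) (FreeObj.mk p) (FreeObj.mk q)
      | smul c p ih =>
        rw [FreeTerm.eval, ← ih]
        exact map_smul (G.map _) c (FreeObj.mk p)
    obtain ⟨⟨gmap, gact⟩, gone, gcomp⟩ := G
    congr 2
    funext n
    refine LinearMap.ext fun x => ?_
    induction x using FreeObj.ind with
    | h p => exact key n p

end Free

/-! ## The operad governing nonassociative permutative algebras -/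

/-- The regular representations `K[Σ_n]`, with right multiplication, as a `Σ`-module. -/
def regularModule (K : Type u) [Field K] : SigmaModule K where
  obj n := MonoidAlgebra K (Equiv.Perm (Fin n))
  act σ := LinearMap.mulRight K (MonoidAlgebra.of K _ σ)
  act_one x := by
    rw [map_one]
    exact mul_one x
  act_mul σ τ x := by simp [mul_assoc]

/-- The `Σ`-module that agrees with `M` in arity `d` and is zero in all other arities. -/
def SigmaModule.concentrated {K : Type u} [Field K] (M : SigmaModule K) (d : ℕ) :
    SigmaModule K where
  obj n := PLift (n = d) → M.obj n
  act σ := (M.act σ).compLeft _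
  act_one _ := funext fun _ => M.act_one _
  act_mul σ τ _ := funext fun _ => M.act_mul σ τ _

/-- The free operad on one binary operation without symmetry, `Free(K[Σ_2])`. -/
def binaryFreeOperad (K : Type u) [Field K] : Operad K :=
  freeOperad ((regularModule K).concentrated 2)

/-- The generating binary operation `μ` of `Free(K[Σ_2])`: the unit of `K[Σ_2]`. -/
def binaryGen (K : Type u) [Field K] : (binaryFreeOperad K).obj 2 :=
  (freeOperad.ι ((regularModule K).concentrated 2)).map 2
    (fun _ => (1 : MonoidAlgebra K (Equiv.Perm (Fin 2))))

/-- The element `(μ ∘_1 μ) · (Id - τ)`, where `τ` is the transposition of the last two of the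
three inputs; it expresses the relation `(ab)c = (ac)b`. -/
def napRelator (K : Type u) [Field K] : (binaryFreeOperad K).obj 3 :=
  (binaryFreeOperad K).comp (by norm_num) 0 (binaryGen K) (binaryGen K) -
    (binaryFreeOperad K).act (Equiv.swap 1 2)
      ((binaryFreeOperad K).comp (by norm_num) 0 (binaryGen K) (binaryGen K))

/-- The space of relations: the sub-`Σ_3`-module of `Free(K[Σ_2])(3)` generated by the relator. -/
def napRelations (K : Type u) [Field K] : Submodule K ((binaryFreeOperad K).obj 3) :=
  Submodule.span K
    (Set.range fun σ : Equiv.Perm (Fin 3) => (binaryFreeOperad K).act σ (napRelator K))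

/-- The ideal of `Free(K[Σ_2])` generated by the relations. -/
def napIdeal (K : Type u) [Field K] : Operad.Ideal (binaryFreeOperad K) :=
  Operad.Ideal.span (binaryFreeOperad K) (napRelations K : Set ((binaryFreeOperad K).obj 3))

/-- The quadratic operad governing nonassociative permutative algebras. -/
def napOperad (K : Type u) [Field K] : Operad K :=
  (binaryFreeOperad K).quotient (napIdeal K)

/-- The generating binary operation of the operad of nonassociative permutative algebras. -/
def napMul (K : Type u) [Field K] : (napOperad K).obj 2 :=
  Submodule.Quotient.mk (binaryGen K)

/-! ## The operad of labeled rooted trees -/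

/-- An `n`-labeled rooted tree, that is, a tree with vertex set `Fin n` and a distinguished
vertex, the root. -/
@[ext]
structure RootedTree (n : ℕ) where
  graph : SimpleGraph (Fin n)
  isTree : graph.IsTree
  root : Fin n

namespace RootedTree

/-- The labels in `T ∘_i S` of the vertices of `T`, where `r` is the root of `S`: the vertex `i`
is replaced by the root of `S`, and the other vertices are renumbered. -/
def outerVertex {n m k : ℕ} (h : k + 1 = n + m) (i : Fin n) (r : Fin m) (j : Fin n) : Fin k :=
  if hj : j = i then inner h i r else outer h i j hj

lemma outerVertex_self {n m k : ℕ} (h : k + 1 = n + m) (i : Fin n) (r : Fin m) :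
    outerVertex h i r i = inner h i r := dif_pos rfl

lemma outerVertex_ne {n m k : ℕ} (h : k + 1 = n + m) (i : Fin n) (r : Fin m) {j : Fin n}
    (hj : j ≠ i) : outerVertex h i r j = outer h i j hj := dif_neg hj

lemma map_sup' {V W : Type*} (f : V → W) (G H : SimpleGraph V) :
    (G ⊔ H).map f = G.map f ⊔ H.map f := by
  ext a b
  simp only [SimpleGraph.map_adj', SimpleGraph.sup_adj]
  constructor
  · rintro ⟨hne, x, y, h | h, rfl, rfl⟩
    · exact Or.inl ⟨hne, x, y, h, rfl, rfl⟩
    · exact Or.inr ⟨hne, x, y, h, rfl, rfl⟩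
  · rintro (⟨hne, x, y, h, rfl, rfl⟩ | ⟨hne, x, y, h, rfl, rfl⟩)
    · exact ⟨hne, x, y, Or.inl h, rfl, rfl⟩
    · exact ⟨hne, x, y, Or.inr h, rfl, rfl⟩

lemma reachable_map {V W : Type*} (f : V → W) {G : SimpleGraph V} {H : SimpleGraph W}
    (hle : G.map f ≤ H) {a b : V} (hab : G.Reachable a b) : H.Reachable (f a) (f b) := by
  obtain ⟨w⟩ := hab
  induction w with
  | nil => exact SimpleGraph.Reachable.refl _
  | cons hadj _ ih =>
    refine SimpleGraph.Reachable.trans ?_ ih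
    rename_i u v _ _
    by_cases e : f u = f v
    · rw [e]
    · exact SimpleGraph.Adj.reachable (hle (SimpleGraph.map_adj_apply' hadj e))

lemma card_edgeSet_map_le {V W : Type*} [Finite V] (f : V → W) (G : SimpleGraph V) :
    (G.map f).edgeSet.ncard ≤ G.edgeSet.ncard := by
  have hsub : (G.map f).edgeSet ⊆ Sym2.map f '' G.edgeSet := by
    intro e he
    induction e using Sym2.ind with
    | h a b =>
      rw [SimpleGraph.mem_edgeSet, SimpleGraph.map_adj'] at he
      obtain ⟨_, x, y, hxy, rfl, rfl⟩ := he
      exact ⟨s(x, y), hxy, rfl⟩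
  exact (Set.ncard_le_ncard hsub (Set.toFinite _)).trans (Set.ncard_image_le (Set.toFinite _))

/-- Two trees glued at one vertex form a tree. -/
lemma isTree_glue {n m k : ℕ} (h : k + 1 = n + m) (i : Fin n) (T : RootedTree n)
    (S : RootedTree m) :
    (T.graph.map (outerVertex h i S.root) ⊔ S.graph.map (inner h i)).IsTree := by
  set G := T.graph.map (outerVertex h i S.root) ⊔ S.graph.map (inner h i) with hG
  have hconn : G.Connected := by
    have key : ∀ x : Fin k, G.Reachable x (inner h i S.root) := by
      intro x
      rcases eq_inner_or_outer h i x with ⟨a, rfl⟩ | ⟨j, hj, rfl⟩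
      · exact reachable_map (inner h i) le_sup_right (S.isTree.connected.preconnected a S.root)
      · have := reachable_map (outerVertex h i S.root) (H := G) le_sup_left
          (T.isTree.connected.preconnected j i)
        rwa [outerVertex_self, outerVertex_ne h i S.root hj] at this
    have : Nonempty (Fin k) := ⟨inner h i S.root⟩
    exact ⟨fun x y => (key x).trans (key y).symm⟩
  rw [SimpleGraph.isTree_iff_connected_and_card]
  refine ⟨hconn, ?_⟩
  have h1 := hconn.card_vert_le_card_edgeSet_add_one
  have hT := (SimpleGraph.isTree_iff_connected_and_card.1 T.isTree).2
  have hS := (SimpleGraph.isTree_iff_connected_and_card.1 S.isTree).2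
  have hle : G.edgeSet.ncard ≤ T.graph.edgeSet.ncard + S.graph.edgeSet.ncard := by
    rw [hG, SimpleGraph.edgeSet_sup]
    exact (Set.ncard_union_le _ _).trans
      (add_le_add (card_edgeSet_map_le _ _) (card_edgeSet_map_le _ _))
  simp only [Nat.card_coe_set_eq, Nat.card_eq_fintype_card (α := Fin _), Fintype.card_fin]
    at h1 hT hS ⊢
  omega

/-- The composition `T ∘_i S`: the tree `S` is substituted for the vertex `i` of `T`. All edges
of `T` at `i` (the outgoing edge, towards the root, as well as the incoming ones) become edges at
the root of `S`; the root is that of `T`, or that of `S` if `i` is the root of `T`. -/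
def subst {n m k : ℕ} (h : k + 1 = n + m) (i : Fin n) (T : RootedTree n) (S : RootedTree m) :
    RootedTree k where
  graph := T.graph.map (outerVertex h i S.root) ⊔ S.graph.map (inner h i)
  isTree := isTree_glue h i T S
  root := outerVertex h i S.root T.root

/-- The right action of the symmetric group on the labels: the vertex of `T` with label `a` has
the label `σ⁻¹ a` in `T · σ`. -/
def relabel {n : ℕ} (σ : Equiv.Perm (Fin n)) (T : RootedTree n) : RootedTree n where
  graph := T.graph.map σ.symm
  isTree := (SimpleGraph.Iso.map σ.symm T.graph).isTree_iff.1 T.isTree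
  root := σ.symm T.root

/-- The tree with one vertex. -/
def single : RootedTree 1 where
  graph := ⊥
  isTree := SimpleGraph.IsTree.of_subsingleton
  root := 0

/-- The tree with two vertices whose root is the first one. -/
def edge : RootedTree 2 where
  graph := ⊤
  isTree := ⟨SimpleGraph.connected_top, SimpleGraph.IsAcyclic.of_card_le_two (by simp)⟩
  root := 0

lemma relabel_one {n : ℕ} (T : RootedTree n) : T.relabel 1 = T := by
  ext1
  · exact SimpleGraph.map_id T.graph
  · rfl

lemma relabel_mul {n : ℕ} (σ τ : Equiv.Perm (Fin n)) (T : RootedTree n) :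
    T.relabel (σ * τ) = (T.relabel σ).relabel τ := by
  ext1
  · simp only [relabel, SimpleGraph.map_map]
    rfl
  · rfl

lemma single_subst {n : ℕ} (h : n + 1 = 1 + n) (T : RootedTree n) :
    subst h 0 single T = T := by
  have e : inner h 0 = id := by
    funext a
    exact Fin.ext (by simp [inner_val])
  ext1
  · simp only [subst, single, e, SimpleGraph.map_id]
    refine sup_eq_right.2 fun a b hab => ?_
    rw [SimpleGraph.map_adj'] at hab
    obtain ⟨_, x, y, hxy, _⟩ := hab
    exact hxy.elim
  · simp only [subst, single]
    rw [outerVertex_self, e, id]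

lemma subst_single {n : ℕ} (h : n + 1 = n + 1) (i : Fin n) (T : RootedTree n) :
    subst h i T single = T := by
  have e : outerVertex h i single.root = id := by
    funext a
    by_cases ha : a = i
    · subst ha
      rw [outerVertex_self]
      exact Fin.ext (by simp [inner_val, single])
    · rw [outerVertex_ne _ _ _ ha]
      refine Fin.ext ?_
      simp [outer_val]
  ext1
  · simp only [subst, e, SimpleGraph.map_id]
    refine sup_eq_left.2 fun a b hab => ?_
    rw [SimpleGraph.map_adj'] at hab
    obtain ⟨_, x, y, hxy, _⟩ := hab
    exact hxy.elim
  · simp only [subst, e, id]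

section Indices

variable {n m l a b k : ℕ}

lemma inner_inner (h₁ : a + 1 = n + m) (h₂ : k + 1 = a + l) (h₃ : b + 1 = m + l)
    (h₄ : k + 1 = n + b) (i : Fin n) (j : Fin m) (c : Fin l) :
    inner h₂ (inner h₁ i j) c = inner h₄ i (inner h₃ j c) :=
  Fin.ext (by simp only [inner_val]; omega)

lemma outerVertex_inner (h₁ : a + 1 = n + m) (h₂ : k + 1 = a + l) (h₃ : b + 1 = m + l)
    (h₄ : k + 1 = n + b) (i : Fin n) (j : Fin m) (r : Fin l) (c : Fin m) :
    outerVertex h₂ (inner h₁ i j) r (inner h₁ i c) = inner h₄ i (outerVertex h₃ j r c) := by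
  by_cases hc : c = j
  · subst hc
    rw [outerVertex_self, outerVertex_self]
    exact inner_inner h₁ h₂ h₃ h₄ i c r
  · rw [outerVertex_ne _ _ _ hc, outerVertex_ne _ _ _ ((inner_injective h₁ i).ne hc)]
    have : (c : ℕ) ≠ j := fun e => hc (Fin.ext e)
    refine Fin.ext ?_
    simp only [inner_val, outer_val, Nat.add_lt_add_iff_left]
    split_ifs <;> omega

lemma outerVertex_outer (h₁ : a + 1 = n + m) (h₂ : k + 1 = a + l) (h₃ : b + 1 = m + l)
    (h₄ : k + 1 = n + b) (i : Fin n) (j s : Fin m) (r : Fin l) (c : Fin n) :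
    outerVertex h₂ (inner h₁ i j) r (outerVertex h₁ i s c) =
      outerVertex h₄ i (outerVertex h₃ j r s) c := by
  by_cases hc : c = i
  · subst hc
    rw [outerVertex_self, outerVertex_self]
    exact outerVertex_inner h₁ h₂ h₃ h₄ c j r s
  · rw [outerVertex_ne _ _ _ hc, outerVertex_ne _ _ _ hc,
      outerVertex_ne _ _ _ (outer_ne_inner h₁ i c hc j)]
    have : (c : ℕ) ≠ i := fun e => hc (Fin.ext e)
    refine Fin.ext ?_
    simp only [inner_val, outer_val]
    split_ifs <;> omega

lemma outerVertex_inner_comm (h₁ : a + 1 = n + m) (h₂ : k + 1 = a + l) (h₃ : b + 1 = n + l)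
    (h₄ : k + 1 = b + m) (i j : Fin n) (hij : i ≠ j) (r : Fin l) (c : Fin m) :
    outerVertex h₂ (outer h₁ i j hij.symm) r (inner h₁ i c) = inner h₄ (outer h₃ j i hij) c := by
  rw [outerVertex_ne _ _ _ (outer_ne_inner h₁ i j hij.symm c).symm]
  have : (i : ℕ) ≠ j := fun e => hij (Fin.ext e)
  refine Fin.ext ?_
  simp only [inner_val, outer_val]
  split_ifs <;> omega

lemma outerVertex_comm (h₁ : a + 1 = n + m) (h₂ : k + 1 = a + l) (h₃ : b + 1 = n + l)
    (h₄ : k + 1 = b + m) (i j : Fin n) (hij : i ≠ j) (s : Fin m) (r : Fin l) (c : Fin n) :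
    outerVertex h₂ (outer h₁ i j hij.symm) r (outerVertex h₁ i s c) =
      outerVertex h₄ (outer h₃ j i hij) s (outerVertex h₃ j r c) := by
  by_cases hci : c = i
  · subst hci
    rw [outerVertex_self, outerVertex_ne _ _ _ hij, outerVertex_self]
    exact outerVertex_inner_comm h₁ h₂ h₃ h₄ c j hij r s
  · by_cases hcj : c = j
    · subst hcj
      rw [outerVertex_ne _ _ _ hci, outerVertex_self, outerVertex_self]
      exact (outerVertex_inner_comm h₃ h₄ h₁ h₂ c i hij.symm s r).symm
    · rw [outerVertex_ne _ _ _ hci, outerVertex_ne _ _ _ hcj,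
        outerVertex_ne _ _ _ (fun e => hcj (outer_inj _ _ _ _ _ _ e)),
        outerVertex_ne _ _ _ (fun e => hci (outer_inj _ _ _ _ _ _ e))]
      have e1 : (i : ℕ) ≠ j := fun e => hij (Fin.ext e)
      have e2 : (c : ℕ) ≠ i := fun e => hci (Fin.ext e)
      have e3 : (c : ℕ) ≠ j := fun e => hcj (Fin.ext e)
      refine Fin.ext ?_
      simp only [outer_val]
      split_ifs <;> omega

lemma compPerm_outerVertex (h : k + 1 = n + m) (i : Fin n) (σ : Equiv.Perm (Fin n))
    (τ : Equiv.Perm (Fin m)) (r : Fin m) (c : Fin n) :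
    compPerm h i σ τ (outerVertex h i r c) = outerVertex h (σ i) (τ r) (σ c) := by
  by_cases hc : c = i
  · subst hc
    rw [outerVertex_self, outerVertex_self, compPerm_inner]
  · rw [outerVertex_ne _ _ _ hc, outerVertex_ne _ _ _ (σ.injective.ne hc), compPerm_outer]

end Indices

lemma subst_assoc {n m l a b k : ℕ} (h₁ : a + 1 = n + m) (h₂ : k + 1 = a + l)
    (h₃ : b + 1 = m + l) (h₄ : k + 1 = n + b) (i : Fin n) (j : Fin m)
    (T : RootedTree n) (S : RootedTree m) (R : RootedTree l) :
    subst h₂ (inner h₁ i j) (subst h₁ i T S) R = subst h₄ i T (subst h₃ j S R) := by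
  ext1
  · simp only [subst, map_sup', SimpleGraph.map_map, sup_assoc]
    have e1 : outerVertex h₂ (inner h₁ i j) R.root ∘ outerVertex h₁ i S.root =
        outerVertex h₄ i (outerVertex h₃ j R.root S.root) :=
      funext (outerVertex_outer h₁ h₂ h₃ h₄ i j S.root R.root)
    have e2 : outerVertex h₂ (inner h₁ i j) R.root ∘ inner h₁ i =
        inner h₄ i ∘ outerVertex h₃ j R.root :=
      funext (outerVertex_inner h₁ h₂ h₃ h₄ i j R.root)
    have e3 : inner h₂ (inner h₁ i j) = inner h₄ i ∘ inner h₃ j :=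
      funext (inner_inner h₁ h₂ h₃ h₄ i j)
    rw [e1, e2, e3]
  · exact outerVertex_outer h₁ h₂ h₃ h₄ i j S.root R.root T.root

lemma subst_comm {n m l a b k : ℕ} (h₁ : a + 1 = n + m) (h₂ : k + 1 = a + l)
    (h₃ : b + 1 = n + l) (h₄ : k + 1 = b + m) (i j : Fin n) (hij : i ≠ j)
    (T : RootedTree n) (S : RootedTree m) (R : RootedTree l) :
    subst h₂ (outer h₁ i j hij.symm) (subst h₁ i T S) R =
      subst h₄ (outer h₃ j i hij) (subst h₃ j T R) S := by
  have e1 : outerVertex h₂ (outer h₁ i j hij.symm) R.root ∘ outerVertex h₁ i S.root =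
      outerVertex h₄ (outer h₃ j i hij) S.root ∘ outerVertex h₃ j R.root :=
    funext (outerVertex_comm h₁ h₂ h₃ h₄ i j hij S.root R.root)
  have e2 : outerVertex h₂ (outer h₁ i j hij.symm) R.root ∘ inner h₁ i =
      inner h₄ (outer h₃ j i hij) :=
    funext (outerVertex_inner_comm h₁ h₂ h₃ h₄ i j hij R.root)
  have e3 : outerVertex h₄ (outer h₃ j i hij) S.root ∘ inner h₃ j =
      inner h₂ (outer h₁ i j hij.symm) :=
    funext (outerVertex_inner_comm h₃ h₄ h₁ h₂ j i hij.symm S.root)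
  ext1
  · simp only [subst, map_sup', SimpleGraph.map_map, e1, e2, e3]
    rw [sup_assoc, sup_assoc, sup_comm (SimpleGraph.map _ S.graph)]
  · exact congrFun e1 T.root

lemma subst_relabel {n m k : ℕ} (h : k + 1 = n + m) (i : Fin n) (σ : Equiv.Perm (Fin n))
    (τ : Equiv.Perm (Fin m)) (T : RootedTree n) (S : RootedTree m) :
    subst h i (T.relabel σ) (S.relabel τ) =
      (subst h (σ i) T S).relabel (compPerm h i σ τ) := by
  have e1 : ∀ c, outerVertex h i (τ.symm S.root) (σ.symm c) =
      (compPerm h i σ τ).symm (outerVertex h (σ i) S.root c) := fun c => by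
    rw [Equiv.eq_symm_apply, compPerm_outerVertex, Equiv.apply_symm_apply,
      Equiv.apply_symm_apply]
  have e2 : ∀ c, inner h i (τ.symm c) =
      (compPerm h i σ τ).symm (inner h (σ i) c) := fun c => by
    rw [Equiv.eq_symm_apply, compPerm_inner, Equiv.apply_symm_apply]
  ext1
  · simp only [subst, relabel, map_sup', SimpleGraph.map_map]
    congr 2
    · exact funext e1
    · exact funext e2
  · exact e1 T.root

end RootedTree

/-- The bilinear extension of the composition of trees. -/
def treeComp (K : Type u) [Field K] {n m k : ℕ} (h : k + 1 = n + m) (i : Fin n) :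
    (RootedTree n →₀ K) →ₗ[K] (RootedTree m →₀ K) →ₗ[K] (RootedTree k →₀ K) :=
  Finsupp.linearCombination K fun T =>
    Finsupp.linearCombination K fun S => Finsupp.single (RootedTree.subst h i T S) 1

lemma treeComp_single (K : Type u) [Field K] {n m k : ℕ} (h : k + 1 = n + m) (i : Fin n)
    (T : RootedTree n) (S : RootedTree m) (c d : K) :
    treeComp K h i (Finsupp.single T c) (Finsupp.single S d) =
      Finsupp.single (RootedTree.subst h i T S) (c * d) := by
  rw [treeComp, Finsupp.linearCombination_single, LinearMap.smul_apply,
    Finsupp.linearCombination_single, Finsupp.smul_single, Finsupp.smul_single, smul_eq_mul,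
    smul_eq_mul, mul_one]

/-- The operad of labeled rooted trees: its space of operations of arity `n` is the vector space
spanned by the `n`-labeled rooted trees. -/
def treeOperad (K : Type u) [Field K] : Operad K where
  obj n := RootedTree n →₀ K
  act σ := Finsupp.lmapDomain K K (RootedTree.relabel σ)
  act_one x := by
    induction x using Finsupp.induction_linear with
    | zero => simp
    | add f g hf hg => rw [map_add, hf, hg]
    | single T c => simp [RootedTree.relabel_one]
  act_mul σ τ x := by
    induction x using Finsupp.induction_linear with
    | zero => simp
    | add f g hf hg => simp only [map_add, hf, hg]
    | single T c => simp [RootedTree.relabel_mul]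
  one := Finsupp.single RootedTree.single 1
  comp h i := treeComp K h i
  one_comp h x := by
    induction x using Finsupp.induction_linear with
    | zero => simp
    | add f g hf hg => rw [map_add, hf, hg]
    | single T c => rw [treeComp_single, RootedTree.single_subst, one_mul]
  comp_one h i x := by
    induction x using Finsupp.induction_linear with
    | zero => simp
    | add f g hf hg => rw [map_add, LinearMap.add_apply, hf, hg]
    | single T c => rw [treeComp_single, RootedTree.subst_single, mul_one]
  comp_assoc h₁ h₂ h₃ h₄ i j x y z := by
    induction x using Finsupp.induction_linear with
    | zero => simp
    | add f g hf hg => simp only [map_add, LinearMap.add_apply, hf, hg]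
    | single T c =>
      induction y using Finsupp.induction_linear with
      | zero => simp
      | add f g hf hg => simp only [map_add, LinearMap.add_apply, hf, hg]
      | single S d =>
        induction z using Finsupp.induction_linear with
        | zero => simp
        | add f g hf hg => simp only [map_add, hf, hg]
        | single R e =>
          simp only [treeComp_single, RootedTree.subst_assoc h₁ h₂ h₃ h₄, mul_assoc]
  comp_comm h₁ h₂ h₃ h₄ i j hij x y z := by
    induction x using Finsupp.induction_linear with
    | zero => simp
    | add f g hf hg => simp only [map_add, LinearMap.add_apply, hf, hg]
    | single T c =>
      induction y using Finsupp.induction_linear with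
      | zero => simp
      | add f g hf hg => simp only [map_add, LinearMap.add_apply, hf, hg]
      | single S d =>
        induction z using Finsupp.induction_linear with
        | zero => simp
        | add f g hf hg => simp only [map_add, LinearMap.add_apply, hf, hg]
        | single R e =>
          simp only [treeComp_single]
          rw [RootedTree.subst_comm h₁ h₂ h₃ h₄ i j hij, mul_right_comm]
  comp_act h i σ τ x y := by
    induction x using Finsupp.induction_linear with
    | zero => simp
    | add f g hf hg => simp only [map_add, LinearMap.add_apply, hf, hg]
    | single T c =>
      induction y using Finsupp.induction_linear with
      | zero => simp
      | add f g hf hg => simp only [map_add, hf, hg]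
      | single S d =>
        simp only [Finsupp.lmapDomain_apply, Finsupp.mapDomain_single, treeComp_single,
          RootedTree.subst_relabel]

end SymOperad

end

noncomputable section

namespace SymOperad

/-! The relation holds for trees: substituting the two-vertex tree into its own root gives the star
with root `0` and leaves `1`, `2`, which is symmetric in its leaves. Hence the universal properties
of the free operad and of the quotient give a morphism from the operad of nonassociative permutative
algebras to trees (`exists_hom_napOperad`). The work lies in showing that it is bijective.

Let `P` be any operad with a binary operation `μ` satisfying `(ab)c = (ac)b`. A rooted tree is built
from its root by attaching one leaf at a time, and attaching a leaf at `i` corresponds to inserting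
`μ` at the input `i` (`graft`). A tree thus gives an operation `evalTree`, defined by choosing some
leaf to remove at each stage. Independence of the choices rests on `Operad.graft_comm`: leaves at
different vertices commute by parallel associativity, leaves at the same vertex by the relation. If
two presentations of a tree remove different leaves, both leaves can be removed, and the
presentations are compared through the smaller tree (`exists_eq_graft_of_graft_eq`,
`graft_evalTree_eq`). It follows that `evalTree` commutes with grafting and relabeling.

The span of the values of `evalTree` contains the unit and `μ` and is closed under relabeling and
composition, so it is everything when `μ` generates `P`, as in the present case. The morphism to
trees sends the value of a tree back to that tree. So the linear map from trees to operations has a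
left inverse and is surjective; hence the morphism is bijective in each arity. Compatibility of the
inverse with the operad structure is then automatic. -/

/-! ### Permutations and the last input -/

/-- The renumbering of the inputs of `p ∘_i μ`, for `μ` binary, under which the first input of `μ`
keeps the number `i` and the second one becomes the last input. -/
def graftPerm {n : ℕ} (i : Fin n) : Equiv.Perm (Fin (n + 1)) :=
  Equiv.ofBijective
    (Fin.lastCases (inner (m := 2) rfl i 1) (RootedTree.outerVertex (m := 2) rfl i 0)) <| by
    rw [← Finite.injective_iff_bijective]
    intro x y
    have key : ∀ j, RootedTree.outerVertex (m := 2) rfl i 0 j ≠ inner (m := 2) rfl i 1 := by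
      intro j hj
      by_cases hji : j = i
      · subst hji
        rw [RootedTree.outerVertex_self] at hj
        exact absurd (inner_injective _ _ hj) (by decide)
      · rw [RootedTree.outerVertex_ne _ _ _ hji] at hj
        exact outer_ne_inner _ _ _ hji _ hj
    refine Fin.lastCases ?_ (fun a => ?_) x <;> refine Fin.lastCases ?_ (fun b => ?_) y
    · simp
    · simpa using fun h => absurd h.symm (key b)
    · simpa using fun h => absurd h (key a)
    · simp only [Fin.lastCases_castSucc, Fin.castSucc_inj]
      intro h
      by_cases ha : a = i <;> by_cases hb : b = i
      · rw [ha, hb]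
      · rw [ha, RootedTree.outerVertex_self, RootedTree.outerVertex_ne _ _ _ hb] at h
        exact absurd h.symm (outer_ne_inner _ _ _ hb _)
      · rw [hb, RootedTree.outerVertex_self, RootedTree.outerVertex_ne _ _ _ ha] at h
        exact absurd h (outer_ne_inner _ _ _ ha _)
      · rw [RootedTree.outerVertex_ne _ _ _ ha, RootedTree.outerVertex_ne _ _ _ hb] at h
        exact outer_inj _ _ _ _ _ _ h

lemma graftPerm_castSucc {n : ℕ} (i j : Fin n) :
    graftPerm i j.castSucc = RootedTree.outerVertex (m := 2) rfl i 0 j := by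
  simp [graftPerm]

lemma graftPerm_last {n : ℕ} (i : Fin n) :
    graftPerm i (Fin.last n) = inner (m := 2) rfl i 1 := by
  simp [graftPerm]

/-- The extension of a permutation of the first `n` inputs by the last one as a fixed point. -/
def extendPerm {n : ℕ} (ρ : Equiv.Perm (Fin n)) : Equiv.Perm (Fin (n + 1)) where
  toFun := Fin.lastCases (Fin.last n) fun j => (ρ j).castSucc
  invFun := Fin.lastCases (Fin.last n) fun j => (ρ.symm j).castSucc
  left_inv x := by refine Fin.lastCases ?_ (fun a => ?_) x <;> simp
  right_inv x := by refine Fin.lastCases ?_ (fun a => ?_) x <;> simp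

@[simp] lemma extendPerm_castSucc {n : ℕ} (ρ : Equiv.Perm (Fin n)) (j : Fin n) :
    extendPerm ρ j.castSucc = (ρ j).castSucc := by
  simp [extendPerm]

@[simp] lemma extendPerm_last {n : ℕ} (ρ : Equiv.Perm (Fin n)) :
    extendPerm ρ (Fin.last n) = Fin.last n := by
  simp [extendPerm]

lemma perm_ext_last {n : ℕ} {σ τ : Equiv.Perm (Fin (n + 1))}
    (hl : σ (Fin.last n) = τ (Fin.last n)) (hc : ∀ j : Fin n, σ j.castSucc = τ j.castSucc) :
    σ = τ :=
  Equiv.ext fun x => Fin.lastCases hl hc x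

lemma exists_extendPerm {n : ℕ} (π : Equiv.Perm (Fin (n + 1))) (h : π (Fin.last n) = Fin.last n) :
    ∃ ρ, π = extendPerm ρ := by
  have hne : ∀ j : Fin n, π j.castSucc ≠ Fin.last n := fun j e =>
    (Fin.castSucc_ne_last j) (π.injective (e.trans h.symm))
  choose f hf using fun j => Fin.exists_castSucc_eq.2 (hne j)
  have hinj : Function.Injective f := fun a b hab => by
    have := hf a
    rw [hab, hf b] at this
    exact (Fin.castSucc_injective _ (π.injective this)).symm
  refine ⟨Equiv.ofBijective f (Finite.injective_iff_bijective.1 hinj), perm_ext_last ?_ ?_⟩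
  · rw [h, extendPerm_last]
  · intro j
    rw [extendPerm_castSucc, ← hf]
    rfl

/-- The transposition of the last two inputs. -/
def lastSwap (n : ℕ) : Equiv.Perm (Fin (n + 2)) :=
  Equiv.swap (Fin.last n).castSucc (Fin.last (n + 1))

@[simp] lemma lastSwap_last (n : ℕ) : lastSwap n (Fin.last (n + 1)) = (Fin.last n).castSucc :=
  Equiv.swap_apply_right _ _

@[simp] lemma lastSwap_castSucc_last (n : ℕ) :
    lastSwap n (Fin.last n).castSucc = Fin.last (n + 1) :=
  Equiv.swap_apply_left _ _

@[simp] lemma lastSwap_castSucc_castSucc {n : ℕ} (j : Fin n) :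
    lastSwap n j.castSucc.castSucc = j.castSucc.castSucc :=
  Equiv.swap_apply_of_ne_of_ne
    (fun e => Fin.castSucc_ne_last j (Fin.castSucc_injective _ e)) (Fin.castSucc_ne_last _)

lemma lastSwap_mul_self (n : ℕ) : lastSwap n * lastSwap n = 1 :=
  Equiv.swap_mul_self _ _

/-- A permutation either fixes the last point, or lies in the double coset of the transposition of
the last two points. -/
lemma exists_eq_extendPerm_mul_lastSwap {n : ℕ} (π : Equiv.Perm (Fin (n + 2)))
    (h : π (Fin.last (n + 1)) ≠ Fin.last (n + 1)) :
    ∃ ρ ρ', π = extendPerm ρ * lastSwap n * extendPerm ρ' := by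
  obtain ⟨x, hx⟩ := Fin.exists_castSucc_eq.2 h
  -- With this `ρ`, the product `extendPerm ρ * lastSwap n` sends the last point where `π` does, so
  -- its inverse times `π` fixes the last point.
  let ρ : Equiv.Perm (Fin (n + 1)) := Equiv.swap x (Fin.last n)
  obtain ⟨ρ', hρ'⟩ := exists_extendPerm ((extendPerm ρ * lastSwap n)⁻¹ * π) (by
    rw [Equiv.Perm.mul_apply, Equiv.Perm.inv_eq_iff_eq, Equiv.Perm.mul_apply, lastSwap_last,
      extendPerm_castSucc, ← hx]
    simp [ρ])
  exact ⟨ρ, ρ', by rw [← hρ', mul_inv_cancel_left]⟩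

/-! ### Attaching a leaf to an operation -/

namespace Operad

variable {K : Type u} [Field K] (P : Operad K) (μ : P.obj 2)

/-- The operation `p(x_0, …, μ(x_i, x_n), …, x_{n-1})`. -/
def graft {n : ℕ} (i : Fin n) : P.obj n →ₗ[K] P.obj (n + 1) :=
  P.act (graftPerm i) ∘ₗ (P.comp (m := 2) rfl i).flip μ

lemma graft_apply {n : ℕ} (i : Fin n) (p : P.obj n) :
    P.graft μ i p = P.act (graftPerm i) (P.comp (m := 2) rfl i p μ) := rfl

lemma act_act_inv {n : ℕ} (σ : Equiv.Perm (Fin n)) (x : P.obj n) :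
    P.act σ⁻¹ (P.act σ x) = x := by
  rw [← P.act_mul, mul_inv_cancel, P.act_one]

/-- This lets closure under grafting and relabeling yield closure under composition with `μ`. -/
lemma comp_eq_act_graft {n : ℕ} (i : Fin n) (p : P.obj n) :
    P.comp (m := 2) rfl i p μ = P.act (graftPerm i)⁻¹ (P.graft μ i p) := by
  rw [graft_apply, act_act_inv]

/-- This is equivariance of `∘_i` with the identity acting on `μ`. The permutation on the right is
just `extendPerm ρ` because `graft` keeps the numbers of the old inputs and puts the new one last.
-/
lemma graft_act {n : ℕ} (i : Fin n) (ρ : Equiv.Perm (Fin n)) (p : P.obj n) :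
    P.graft μ i (P.act ρ p) = P.act (extendPerm ρ) (P.graft μ (ρ i) p) := by
  have h := P.comp_act (m := 2) rfl i ρ 1 p μ
  rw [P.act_one] at h
  rw [graft_apply, graft_apply, h, ← P.act_mul, ← P.act_mul]
  congr 1
  refine congrArg _ (perm_ext_last ?_ fun j => ?_)
  · simp only [Equiv.Perm.mul_apply, graftPerm_last, extendPerm_last, compPerm_inner,
      Equiv.Perm.one_apply]
  · simp only [Equiv.Perm.mul_apply, graftPerm_castSucc, extendPerm_castSucc,
      RootedTree.compPerm_outerVertex, Equiv.Perm.one_apply]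

/-- Equivariance moves the inner renumbering outside. Two grafts become two plain partial
compositions, to which the associativity axioms apply, followed by a single permutation; the next
three lemmas compute that permutation on the old inputs and on the two new ones. -/
lemma graft_graft_apply {n : ℕ} (i j : Fin n) (p : P.obj n) :
    P.graft μ j.castSucc (P.graft μ i p) =
      P.act (compPerm (m := 2) rfl j.castSucc (graftPerm i) 1 * graftPerm j.castSucc)
        (P.comp (m := 2) rfl (RootedTree.outerVertex (m := 2) rfl i 0 j)
          (P.comp (m := 2) rfl i p μ) μ) := by
  have h := P.comp_act (m := 2) rfl j.castSucc (graftPerm i) 1 (P.comp (m := 2) rfl i p μ) μ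
  rw [P.act_one, graftPerm_castSucc] at h
  rw [graft_apply, graft_apply, h, ← P.act_mul]

variable {P μ}

lemma compPerm_mul_graftPerm_castSucc_castSucc {n : ℕ} (i j c : Fin n) :
    (compPerm (m := 2) rfl j.castSucc (graftPerm i) 1 * graftPerm j.castSucc)
      c.castSucc.castSucc =
      RootedTree.outerVertex (m := 2) rfl (RootedTree.outerVertex (m := 2) rfl i 0 j) 0
        (RootedTree.outerVertex (m := 2) rfl i 0 c) := by
  rw [Equiv.Perm.mul_apply, graftPerm_castSucc, RootedTree.compPerm_outerVertex,
    graftPerm_castSucc, graftPerm_castSucc, Equiv.Perm.one_apply]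

lemma compPerm_mul_graftPerm_castSucc_last {n : ℕ} (i j : Fin n) :
    (compPerm (m := 2) rfl j.castSucc (graftPerm i) 1 * graftPerm j.castSucc)
      (Fin.last n).castSucc =
      RootedTree.outerVertex (m := 2) rfl (RootedTree.outerVertex (m := 2) rfl i 0 j) 0
        (inner (m := 2) rfl i 1) := by
  rw [Equiv.Perm.mul_apply, graftPerm_castSucc, RootedTree.compPerm_outerVertex,
    graftPerm_castSucc, graftPerm_last, Equiv.Perm.one_apply]

lemma compPerm_mul_graftPerm_last {n : ℕ} (i j : Fin n) :
    (compPerm (m := 2) rfl j.castSucc (graftPerm i) 1 * graftPerm j.castSucc)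
      (Fin.last (n + 1)) =
      inner (m := 2) rfl (RootedTree.outerVertex (m := 2) rfl i 0 j) 1 := by
  rw [Equiv.Perm.mul_apply, graftPerm_last, compPerm_inner, graftPerm_castSucc,
    Equiv.Perm.one_apply]

/-- The relation `(ab)c = (ac)b` for a binary operation of an operad. -/
def IsNAP (P : Operad K) (μ : P.obj 2) : Prop :=
  P.comp (n := 2) (m := 2) (k := 3) rfl 0 μ μ =
    P.act (Equiv.swap 1 2) (P.comp (n := 2) (m := 2) (k := 3) rfl 0 μ μ)

/-- Two new leaves can be grafted in either order. -/
lemma graft_comm (hμ : IsNAP P μ) {n : ℕ} (i j : Fin n) (p : P.obj n) :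
    P.graft μ j.castSucc (P.graft μ i p) =
      P.act (lastSwap n) (P.graft μ i.castSucc (P.graft μ j p)) := by
  rw [graft_graft_apply, graft_graft_apply, ← P.act_mul]
  by_cases hij : i = j
  · subst hij
    -- Both leaves sit at the same vertex: sequential associativity exposes `p ∘_i (μ ∘_0 μ)`, and
    -- the relation makes this operation invariant under exchange of the inputs `1` and `2` of `μ
    -- ∘_0 μ`, which are the two new leaves.
    have hassoc := P.comp_assoc (n := n) (m := 2) (l := 2) rfl rfl (b := 3) rfl rfl i 0 p μ μ
    have hact := P.comp_act (n := n) (m := 3) rfl i 1 (Equiv.swap 1 2) p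
      (P.comp (n := 2) (m := 2) (k := 3) rfl 0 μ μ)
    rw [P.act_one, ← hμ, Equiv.Perm.one_apply] at hact
    rw [RootedTree.outerVertex_self, hassoc]
    conv_lhs => rw [hact]
    rw [← P.act_mul]
    congr 1
    refine congrArg _ (perm_ext_last ?_ fun j => Fin.lastCases ?_ (fun c => ?_) j)
    · rw [Equiv.Perm.mul_apply, compPerm_mul_graftPerm_last, Equiv.Perm.mul_apply _ (lastSwap n),
        lastSwap_last, compPerm_mul_graftPerm_castSucc_last, RootedTree.outerVertex_self,
        RootedTree.inner_inner (m := 2) (l := 2) rfl rfl (b := 3) rfl rfl,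
        RootedTree.outerVertex_inner (m := 2) (l := 2) rfl rfl (b := 3) rfl rfl, compPerm_inner]
      rfl
    · rw [Equiv.Perm.mul_apply, compPerm_mul_graftPerm_castSucc_last,
        Equiv.Perm.mul_apply _ (lastSwap n),
        lastSwap_castSucc_last, compPerm_mul_graftPerm_last, RootedTree.outerVertex_self,
        RootedTree.inner_inner (m := 2) (l := 2) rfl rfl (b := 3) rfl rfl,
        RootedTree.outerVertex_inner (m := 2) (l := 2) rfl rfl (b := 3) rfl rfl, compPerm_inner]
      rfl
    · rw [Equiv.Perm.mul_apply, compPerm_mul_graftPerm_castSucc_castSucc,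
        Equiv.Perm.mul_apply _ (lastSwap n),
        lastSwap_castSucc_castSucc, compPerm_mul_graftPerm_castSucc_castSucc,
        RootedTree.outerVertex_self,
        RootedTree.outerVertex_outer (m := 2) (l := 2) rfl rfl (b := 3) rfl rfl,
        RootedTree.compPerm_outerVertex]
      rfl
  -- The leaves sit at different vertices: parallel associativity suffices, and the relation is not
  -- needed.
  · rw [RootedTree.outerVertex_ne _ _ _ (Ne.symm hij), RootedTree.outerVertex_ne _ _ _ hij,
      P.comp_comm (n := n) (m := 2) (l := 2) rfl rfl rfl rfl i j hij p μ μ]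
    congr 1
    refine congrArg _ (perm_ext_last ?_ fun x => Fin.lastCases ?_ (fun c => ?_) x)
    · rw [compPerm_mul_graftPerm_last, Equiv.Perm.mul_apply _ (lastSwap n),
        lastSwap_last, compPerm_mul_graftPerm_castSucc_last,
        RootedTree.outerVertex_ne _ _ _ (Ne.symm hij), RootedTree.outerVertex_ne _ _ _ hij]
      exact (RootedTree.outerVertex_inner_comm (m := 2) (l := 2) rfl rfl rfl rfl j i
        (Ne.symm hij) 0 1).symm
    · rw [compPerm_mul_graftPerm_castSucc_last, Equiv.Perm.mul_apply _ (lastSwap n),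
        lastSwap_castSucc_last, compPerm_mul_graftPerm_last,
        RootedTree.outerVertex_ne _ _ _ (Ne.symm hij), RootedTree.outerVertex_ne _ _ _ hij]
      exact RootedTree.outerVertex_inner_comm (m := 2) (l := 2) rfl rfl rfl rfl i j hij 0 1
    · rw [compPerm_mul_graftPerm_castSucc_castSucc, Equiv.Perm.mul_apply _ (lastSwap n),
        lastSwap_castSucc_castSucc, compPerm_mul_graftPerm_castSucc_castSucc,
        RootedTree.outerVertex_ne _ _ _ (Ne.symm hij), RootedTree.outerVertex_ne _ _ _ hij]
      exact RootedTree.outerVertex_comm (m := 2) (l := 2) rfl rfl rfl rfl i j hij 0 0 c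

end Operad

/-! ### Leaves of rooted trees -/

namespace RootedTree

/-- The tree obtained by attaching a new leaf, with the last label, to the vertex `i`. -/
def graft {n : ℕ} (T : RootedTree n) (i : Fin n) : RootedTree (n + 1) :=
  (subst (m := 2) rfl i T edge).relabel (graftPerm i)

lemma graft_root {n : ℕ} (T : RootedTree n) (i : Fin n) :
    (T.graft i).root = T.root.castSucc := by
  change (graftPerm i).symm (outerVertex (m := 2) rfl i 0 T.root) = _
  rw [Equiv.symm_apply_eq, graftPerm_castSucc]

/-- The permutation `graftPerm i` is designed to cancel the renumbering of `∘_i`: old vertices keep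
their numbers, and the edge of the inserted tree joins `i` to the new last vertex. -/
lemma graft_graph {n : ℕ} (T : RootedTree n) (i : Fin n) :
    (T.graft i).graph =
      T.graph.map Fin.castSucc ⊔ SimpleGraph.edge i.castSucc (Fin.last n) := by
  have e1 : (graftPerm i).symm ∘ outerVertex (m := 2) rfl i 0 = Fin.castSucc := by
    funext j
    rw [Function.comp_apply, Equiv.symm_apply_eq, graftPerm_castSucc]
  have e2 : (graftPerm i).symm ∘ inner (m := 2) rfl i = ![i.castSucc, Fin.last n] := by
    funext j
    rw [Function.comp_apply, Equiv.symm_apply_eq]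
    fin_cases j
    · simp [graftPerm_castSucc, outerVertex_self]
    · simp [graftPerm_last]
  change SimpleGraph.map _ (T.graph.map _ ⊔ SimpleGraph.map _ ⊤) = _
  rw [map_sup', SimpleGraph.map_map, SimpleGraph.map_map]
  refine congrArg₂ _ (congrArg (fun f => SimpleGraph.map f T.graph) e1) ?_
  refine (congrArg (fun f => SimpleGraph.map f ⊤) e2).trans ?_
  ext a b
  simp only [SimpleGraph.map_adj', SimpleGraph.edge_adj, SimpleGraph.top_adj, Fin.exists_fin_two,
    Matrix.cons_val_zero, Matrix.cons_val_one]
  grind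

lemma graft_adj_castSucc {n : ℕ} (T : RootedTree n) (i a b : Fin n) :
    (T.graft i).graph.Adj a.castSucc b.castSucc ↔ T.graph.Adj a b := by
  rw [graft_graph, SimpleGraph.sup_adj, SimpleGraph.edge_adj, SimpleGraph.map_adj']
  constructor
  · rintro (⟨-, x, y, h, hx, hy⟩ | ⟨h, -⟩)
    · rwa [← Fin.castSucc_injective _ hx, ← Fin.castSucc_injective _ hy]
    · have := Fin.castSucc_ne_last a
      have := Fin.castSucc_ne_last b
      grind
  · exact fun h => Or.inl ⟨(Fin.castSucc_injective _).ne h.ne, a, b, h, rfl, rfl⟩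

lemma graft_adj_last {n : ℕ} (T : RootedTree n) (i : Fin n) (b : Fin (n + 1)) :
    (T.graft i).graph.Adj (Fin.last n) b ↔ b = i.castSucc := by
  rw [graft_graph, SimpleGraph.sup_adj, SimpleGraph.edge_adj, SimpleGraph.map_adj']
  constructor
  · rintro (⟨-, x, y, h, hx, hy⟩ | ⟨h, -⟩)
    · exact absurd hx (Fin.castSucc_ne_last _)
    · have := Fin.castSucc_ne_last i
      grind
  · rintro rfl
    exact Or.inr ⟨Or.inr ⟨rfl, rfl⟩, (Fin.castSucc_ne_last _).symm⟩

/-- The tree is recovered by restricting to the old vertices, and the vertex of attachment is the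
only neighbour of the last vertex. -/
lemma graft_injective {n : ℕ} {T T' : RootedTree n} {i i' : Fin n}
    (h : T.graft i = T'.graft i') : T = T' ∧ i = i' := by
  refine ⟨RootedTree.ext ?_ ?_, ?_⟩
  · ext a b
    rw [← graft_adj_castSucc T i, h, graft_adj_castSucc]
  · apply Fin.castSucc_injective
    rw [← graft_root T i, h, graft_root]
  · apply Fin.castSucc_injective
    rw [← graft_adj_last T' i', ← h, graft_adj_last]

lemma relabel_adj {n : ℕ} (T : RootedTree n) (σ : Equiv.Perm (Fin n)) (a b : Fin n) :
    (T.relabel σ).graph.Adj a b ↔ T.graph.Adj (σ a) (σ b) := by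
  conv_lhs => rw [← σ.symm_apply_apply a, ← σ.symm_apply_apply b]
  exact (SimpleGraph.Iso.map σ.symm T.graph).map_adj_iff

lemma relabel_root {n : ℕ} (T : RootedTree n) (σ : Equiv.Perm (Fin n)) :
    (T.relabel σ).root = σ.symm T.root := rfl

/-- A tree whose last vertex is a leaf other than the root arises by attaching this leaf. -/
lemma exists_eq_graft {n : ℕ} (T : RootedTree (n + 1)) (i : Fin n)
    (hr : T.root ≠ Fin.last n) (hi : ∀ b, T.graph.Adj (Fin.last n) b ↔ b = i.castSucc) :
    ∃ T' : RootedTree n, T = T'.graft i := by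
  classical
  obtain ⟨r, hr'⟩ := Fin.exists_castSucc_eq.2 hr
  have hdeg : T.graph.degree (Fin.last n) = 1 := by
    rw [SimpleGraph.degree_eq_one_iff_existsUnique_adj]
    exact ⟨i.castSucc, (hi _).2 rfl, fun b hb => (hi b).1 hb⟩
  -- Deleting a vertex of degree one preserves connectedness. The homomorphism `f` carries this from
  -- the induced subgraph to the graph on `Fin n`.
  have hconn := T.isTree.connected.induce_compl_singleton_of_degree_eq_one hdeg
  let f : T.graph.induce {Fin.last n}ᶜ →g T.graph.comap Fin.castSucc :=
    { toFun := fun x => x.1.castPred x.2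
      map_rel' := fun {a b} h => by
        have ha : (a.1.castPred a.2).castSucc = a.1 := Fin.castSucc_castPred _ _
        have hb : (b.1.castPred b.2).castSucc = b.1 := Fin.castSucc_castPred _ _
        exact (congrArg₂ T.graph.Adj ha hb).mpr h }
  have hf : Function.Surjective f := fun x =>
    ⟨⟨x.castSucc, Fin.castSucc_ne_last x⟩, Fin.castPred_castSucc⟩
  let T' : RootedTree n :=
    { graph := T.graph.comap Fin.castSucc
      isTree := ⟨hconn.map f hf,
        T.isTree.isAcyclic.comap ⟨Fin.castSucc, fun h => h⟩ (Fin.castSucc_injective n)⟩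
      root := r }
  refine ⟨T', RootedTree.ext ?_ ?_⟩
  · ext a b
    refine Fin.lastCases ?_ (fun a => ?_) a
    · rw [hi, graft_adj_last]
    · refine Fin.lastCases ?_ (fun b => ?_) b
      · rw [SimpleGraph.adj_comm, hi, SimpleGraph.adj_comm, graft_adj_last]
      · rw [graft_adj_castSucc]
        rfl
  · rw [graft_root, ← hr']

/-- Up to the labels, every tree with more than one vertex arises by attaching a leaf. -/
lemma exists_eq_relabel_graft {n : ℕ} (T : RootedTree (n + 2)) :
    ∃ (T' : RootedTree (n + 1)) (i : Fin (n + 1)) (σ : Equiv.Perm (Fin (n + 2))),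
      T = (T'.graft i).relabel σ := by
  classical
  -- A tree with at least two vertices has two distinct vertices of degree one, and they cannot both
  -- be the root.
  obtain ⟨v, hv, hd⟩ : ∃ v, v ≠ T.root ∧ T.graph.degree v = 1 := by
    obtain ⟨u, v, huv, hu, hv⟩ := T.isTree.exists_ne_and_degree_eq_one
    by_cases h : u = T.root
    · exact ⟨v, fun e => huv (h.trans e.symm), hv⟩
    · exact ⟨u, h, hu⟩
  obtain ⟨w, hw, hw'⟩ := SimpleGraph.degree_eq_one_iff_existsUnique_adj.1 hd
  let σ : Equiv.Perm (Fin (n + 2)) := Equiv.swap v (Fin.last (n + 1))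
  have hσ : σ (Fin.last (n + 1)) = v := Equiv.swap_apply_right _ _
  have hadj : ∀ b, (T.relabel σ).graph.Adj (Fin.last (n + 1)) b ↔ b = σ.symm w := fun b => by
    rw [relabel_adj, hσ, Equiv.eq_symm_apply]
    exact ⟨fun h => hw' _ h, fun h => h ▸ hw⟩
  have hne : σ.symm w ≠ Fin.last (n + 1) := fun e =>
    (T.relabel σ).graph.irrefl (e ▸ (hadj _).2 rfl)
  obtain ⟨i, hi⟩ := Fin.exists_castSucc_eq.2 hne
  obtain ⟨T', hT'⟩ := exists_eq_graft (T.relabel σ) i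
    (by
      rw [relabel_root, Ne, Equiv.symm_apply_eq, hσ]
      exact hv.symm)
    (by rwa [← hi] at hadj)
  refine ⟨T', i, σ⁻¹, ?_⟩
  rw [← hT', ← relabel_mul, mul_inv_cancel, relabel_one]

lemma eq_single (T : RootedTree 1) : T = single := by
  ext1
  · exact Subsingleton.elim _ _
  · exact Subsingleton.elim _ _

instance : IsEmpty (RootedTree 0) := ⟨fun T => T.root.elim0⟩

instance : Unique (RootedTree 1) := ⟨⟨single⟩, eq_single⟩

end RootedTree

/-! ### Trees as operations, and the relation they satisfy -/

/-- A labeled rooted tree, as an operation of the operad of rooted trees. -/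
def treeMonomial (K : Type u) [Field K] {n : ℕ} (T : RootedTree n) : (treeOperad K).obj n :=
  Finsupp.single T (1 : K)

lemma treeMonomial_injective (K : Type u) [Field K] {n : ℕ} :
    Function.Injective (treeMonomial K (n := n)) :=
  Finsupp.single_left_injective one_ne_zero

section

variable {K : Type u} [Field K]

lemma act_treeMonomial {n : ℕ} (σ : Equiv.Perm (Fin n)) (T : RootedTree n) :
    (treeOperad K).act σ (treeMonomial K T) = treeMonomial K (T.relabel σ) :=
  Finsupp.mapDomain_single

lemma comp_treeMonomial {n m k : ℕ} (h : k + 1 = n + m) (i : Fin n) (T : RootedTree n)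
    (S : RootedTree m) :
    (treeOperad K).comp h i (treeMonomial K T) (treeMonomial K S) =
      treeMonomial K (RootedTree.subst h i T S) :=
  (treeComp_single K h i T S 1 1).trans (by rw [mul_one]; rfl)

lemma graft_treeMonomial {n : ℕ} (i : Fin n) (T : RootedTree n) :
    (treeOperad K).graft (treeMonomial K RootedTree.edge) i (treeMonomial K T) =
      treeMonomial K (T.graft i) := by
  rw [Operad.graft_apply, comp_treeMonomial, act_treeMonomial]
  rfl

/-- Both trees are the star with root `0` and leaves `1` and `2`; adjacency on three vertices is a
finite check. -/
lemma RootedTree.subst_edge_edge (h : 3 + 1 = 2 + 2) :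
    RootedTree.subst h 0 RootedTree.edge RootedTree.edge =
      (RootedTree.subst h 0 RootedTree.edge RootedTree.edge).relabel (Equiv.swap 1 2) := by
  ext1
  · change SimpleGraph.map _ ⊤ ⊔ SimpleGraph.map _ ⊤ =
      SimpleGraph.map _ (SimpleGraph.map _ ⊤ ⊔ SimpleGraph.map _ ⊤)
    ext a b
    simp only [SimpleGraph.sup_adj, SimpleGraph.map_adj', SimpleGraph.top_adj]
    revert h a b
    simp only [RootedTree.edge]
    decide
  · rfl

lemma isNAP_treeMonomial_edge :
    Operad.IsNAP (treeOperad K) (treeMonomial K RootedTree.edge) := by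
  rw [Operad.IsNAP, comp_treeMonomial, act_treeMonomial, ← RootedTree.subst_edge_edge]

end

namespace RootedTree

/-- Distinct trees are distinct basis vectors, so the identity can be read off from
`Operad.graft_act` in the tree operad; the coefficient field `ℚ` is an arbitrary choice. -/
lemma graft_relabel {n : ℕ} (T : RootedTree n) (i : Fin n) (ρ : Equiv.Perm (Fin n)) :
    (T.relabel ρ).graft i = (T.graft (ρ i)).relabel (extendPerm ρ) := by
  apply treeMonomial_injective ℚ
  rw [← graft_treeMonomial, ← act_treeMonomial, Operad.graft_act, graft_treeMonomial,
    act_treeMonomial]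

/-- The same transfer, applied to `Operad.graft_comm`; the relation required there is the symmetry
of the star. -/
lemma graft_comm {n : ℕ} (T : RootedTree n) (i j : Fin n) :
    (T.graft i).graft j.castSucc = ((T.graft j).graft i.castSucc).relabel (lastSwap n) := by
  apply treeMonomial_injective ℚ
  rw [← act_treeMonomial, ← graft_treeMonomial, ← graft_treeMonomial, ← graft_treeMonomial,
    ← graft_treeMonomial, Operad.graft_comm isNAP_treeMonomial_edge]

/-- If two trees with attached leaves differ by the transposition of the last two labels, then both
arise from one tree by attaching two leaves. -/
lemma exists_eq_graft_of_graft_eq {n : ℕ} {T T' : RootedTree (n + 1)} {i i' : Fin (n + 1)}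
    (h : T.graft i = (T'.graft i').relabel (lastSwap n)) :
    ∃ (S : RootedTree n) (a b : Fin n),
      T = S.graft a ∧ T' = S.graft b ∧ i = b.castSucc ∧ i' = a.castSucc := by
  -- The transposition is an involution, so the hypothesis is symmetric in the two trees and this
  -- one-sided claim can be applied to each.
  have key : ∀ {T T' : RootedTree (n + 1)} {i i' : Fin (n + 1)},
      T.graft i = (T'.graft i').relabel (lastSwap n) →
      ∃ (S : RootedTree n) (a b : Fin n), T = S.graft a ∧ i = b.castSucc := by
    intro T T' i i' h
    -- The transposition matches the vertex `n` of `T.graft i` with the last leaf of `T'.graft i'`,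
    -- so `n` has just one neighbour there and is not the root.
    have hadj : ∀ b, (T.graft i).graph.Adj (Fin.last n).castSucc b ↔
        lastSwap n b = i'.castSucc := fun b => by
      rw [h, relabel_adj, lastSwap_castSucc_last, graft_adj_last]
    have hroot : T.root ≠ Fin.last n := fun e => by
      have h1 := graft_root T i
      rw [h, relabel_root, graft_root, e, Equiv.symm_apply_eq, lastSwap_castSucc_last] at h1
      exact Fin.castSucc_ne_last _ h1
    have hn : Nontrivial (Fin (n + 1)) := ⟨_, _, hroot⟩
    obtain ⟨c, hc⟩ := T.isTree.connected.preconnected.exists_adj_of_nontrivial (Fin.last n)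
    have hc' := (hadj c.castSucc).1 ((graft_adj_castSucc _ _ _ _).2 hc)
    have huniq : ∀ b, T.graph.Adj (Fin.last n) b ↔ b = c := fun b =>
      ⟨fun hb => Fin.castSucc_injective _ ((lastSwap n).injective
        (((hadj b.castSucc).1 ((graft_adj_castSucc _ _ _ _).2 hb)).trans hc'.symm)),
        fun hb => hb ▸ hc⟩
    obtain ⟨a, ha⟩ := Fin.exists_castSucc_eq.2 hc.ne'
    obtain ⟨S, hS⟩ := exists_eq_graft T a hroot (by rwa [← ha] at huniq)
    -- Otherwise the vertex `n` would have two neighbours in `T.graft i`: its neighbour `c` in `T`,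
    -- and the newly attached leaf.
    have hi : i ≠ Fin.last n := fun e => by
      subst e
      have h1 := (hadj (Fin.last (n + 1))).1 ((SimpleGraph.adj_comm _ _ _).1
        ((graft_adj_last T _ _).2 rfl))
      exact Fin.castSucc_ne_last c ((lastSwap n).injective (hc'.trans h1.symm))
    obtain ⟨b, hb⟩ := Fin.exists_castSucc_eq.2 hi
    exact ⟨S, a, b, hS, hb.symm⟩
  obtain ⟨S, a, b, rfl, rfl⟩ := key h
  have h' : T'.graft i' = ((S.graft a).graft b.castSucc).relabel (lastSwap n) := by
    rw [h, ← relabel_mul, lastSwap_mul_self, relabel_one]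
  obtain ⟨S', a', b', rfl, rfl⟩ := key h'
  -- Exchanging the leaves turns the right side into `(S.graft b).graft a.castSucc`, so injectivity
  -- of grafting identifies `T'` and `i'` without comparing `S'` and `S` directly.
  rw [← graft_comm] at h'
  obtain ⟨h1, h2⟩ := graft_injective h'
  exact ⟨S, a, b, rfl, h1, rfl, h2⟩

end RootedTree

/-! ### Evaluating trees in an operad -/

namespace Operad

variable {K : Type u} [Field K]

section EvalTree

variable (P : Operad K) (μ : P.obj 2)

/-- The operation obtained by building up a tree from its root, one leaf at a time. -/
def evalTree : ∀ {n : ℕ}, RootedTree n → P.obj n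
  | 0, T => T.root.elim0
  | 1, _ => P.one
  | _ + 2, T =>
    P.act T.exists_eq_relabel_graft.choose_spec.choose_spec.choose
      (P.graft μ T.exists_eq_relabel_graft.choose_spec.choose
        (evalTree T.exists_eq_relabel_graft.choose))

lemma evalTree_one (T : RootedTree 1) : P.evalTree μ T = P.one := by
  rw [evalTree]

lemma exists_evalTree_eq {n : ℕ} (T : RootedTree (n + 2)) :
    ∃ (T' : RootedTree (n + 1)) (i : Fin (n + 1)) (σ : Equiv.Perm (Fin (n + 2))),
      T = (T'.graft i).relabel σ ∧
        P.evalTree μ T = P.act σ (P.graft μ i (P.evalTree μ T')) :=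
  ⟨_, _, _, T.exists_eq_relabel_graft.choose_spec.choose_spec.choose_spec, by rw [evalTree]⟩

variable {P μ}

/-- The evaluations of two trees with attached leaves that differ by a relabeling correspond,
provided that evaluation is compatible with relabelings and, for smaller trees, with grafting. -/
lemma graft_evalTree_eq (hμ : IsNAP P μ) {n : ℕ}
    (hS : ∀ (S : RootedTree n) (a : Fin n),
      P.evalTree μ (S.graft a) = P.graft μ a (P.evalTree μ S))
    (hE : ∀ (T : RootedTree (n + 1)) (ρ : Equiv.Perm (Fin (n + 1))),
      P.evalTree μ (T.relabel ρ) = P.act ρ (P.evalTree μ T))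
    {T T' : RootedTree (n + 1)} {i i' : Fin (n + 1)} {π : Equiv.Perm (Fin (n + 2))}
    (h : T.graft i = (T'.graft i').relabel π) :
    P.graft μ i (P.evalTree μ T) = P.act π (P.graft μ i' (P.evalTree μ T')) := by
  -- If `π` fixes the last label, both presentations remove the same leaf, and the smaller trees
  -- differ by a relabeling.
  by_cases hπ : π (Fin.last (n + 1)) = Fin.last (n + 1)
  · obtain ⟨ρ, rfl⟩ := exists_extendPerm π hπ
    obtain ⟨j, rfl⟩ := ρ.surjective i'
    rw [← RootedTree.graft_relabel] at h
    obtain ⟨rfl, rfl⟩ := RootedTree.graft_injective h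
    rw [hE, graft_act]
  · obtain ⟨ρ, ρ', rfl⟩ := exists_eq_extendPerm_mul_lastSwap π hπ
    obtain ⟨j, rfl⟩ := ρ.surjective i'
    rw [RootedTree.relabel_mul, RootedTree.relabel_mul, ← RootedTree.graft_relabel] at h
    -- The presentations remove different leaves. Absorbing `ρ` and `ρ'` into the smaller trees
    -- leaves only the transposition of the last two labels, so both smaller trees arise from a
    -- common `S` by attaching one leaf each.
    have h' : (T.relabel ρ'⁻¹).graft (ρ' i) =
        ((T'.relabel ρ).graft j).relabel (lastSwap n) := by
      have hT : T = (T.relabel ρ'⁻¹).relabel ρ' := by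
        rw [← RootedTree.relabel_mul, inv_mul_cancel, RootedTree.relabel_one]
      rw [hT, RootedTree.graft_relabel] at h
      have h2 := congrArg (RootedTree.relabel (extendPerm ρ')⁻¹) h
      rwa [← RootedTree.relabel_mul, ← RootedTree.relabel_mul, mul_inv_cancel,
        RootedTree.relabel_one, RootedTree.relabel_one] at h2
    obtain ⟨S, a, b, h1, h2, h3, h4⟩ := RootedTree.exists_eq_graft_of_graft_eq h'
    have e1 : P.evalTree μ T = P.act ρ' (P.graft μ a (P.evalTree μ S)) := by
      rw [← hS, ← h1, hE, ← P.act_mul, inv_mul_cancel, P.act_one]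
    have e2 : P.act ρ (P.evalTree μ T') = P.graft μ b (P.evalTree μ S) := by
      rw [← hS, ← h2, hE]
    rw [e1, graft_act, h3, P.act_mul, P.act_mul, ← graft_act, e2, h4, ← graft_comm hμ]

/-- The two claims need a joint induction: comparing presentations of a tree with `n + 2` vertices
uses grafting onto trees with `n` vertices and relabeling of trees with `n + 1`. Applied to the
chosen presentations, `graft_evalTree_eq` then gives both claims one size up. -/
lemma evalTree_graft_and_relabel (hμ : IsNAP P μ) (n : ℕ) :
    (∀ (T : RootedTree n) (a : Fin n),
      P.evalTree μ (T.graft a) = P.graft μ a (P.evalTree μ T)) ∧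
    ∀ (T : RootedTree (n + 1)) (σ : Equiv.Perm (Fin (n + 1))),
      P.evalTree μ (T.relabel σ) = P.act σ (P.evalTree μ T) := by
  induction n with
  | zero =>
    refine ⟨fun T => T.root.elim0, fun T σ => ?_⟩
    obtain rfl : σ = 1 := Equiv.ext fun x => Subsingleton.elim (α := Fin 1) _ _
    rw [P.act_one, RootedTree.relabel_one]
  | succ n ih =>
    refine ⟨fun T a => ?_, fun T σ => ?_⟩
    · obtain ⟨T', i', σ, h, h'⟩ := P.exists_evalTree_eq μ (T.graft a)
      rw [h', graft_evalTree_eq hμ ih.1 ih.2 h]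
    · obtain ⟨T', i', τ, h, h'⟩ := P.exists_evalTree_eq μ T
      obtain ⟨T₁, i₁, τ₁, h₁, h₁'⟩ := P.exists_evalTree_eq μ (T.relabel σ)
      have e : T₁.graft i₁ = (T'.graft i').relabel (τ * σ * τ₁⁻¹) := by
        rw [RootedTree.relabel_mul, RootedTree.relabel_mul, ← h, h₁, ← RootedTree.relabel_mul,
          mul_inv_cancel, RootedTree.relabel_one]
      rw [h', h₁', graft_evalTree_eq hμ ih.1 ih.2 e, ← P.act_mul, ← P.act_mul,
        inv_mul_cancel_right]

lemma evalTree_graft (hμ : IsNAP P μ) {n : ℕ} (T : RootedTree n) (a : Fin n) :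
    P.evalTree μ (T.graft a) = P.graft μ a (P.evalTree μ T) :=
  (evalTree_graft_and_relabel hμ n).1 T a

lemma evalTree_relabel (hμ : IsNAP P μ) {n : ℕ} (T : RootedTree n) (σ : Equiv.Perm (Fin n)) :
    P.evalTree μ (T.relabel σ) = P.act σ (P.evalTree μ T) := by
  cases n with
  | zero => exact T.root.elim0
  | succ n => exact (evalTree_graft_and_relabel hμ n).2 T σ

/-! ### The span of the tree operations is closed under the operad structure -/

variable (P μ) in
/-- The span of the operations that are given by trees. -/
def treeSpan (n : ℕ) : Submodule K (P.obj n) :=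
  Submodule.span K (Set.range fun T : RootedTree n => P.evalTree μ T)

lemma evalTree_mem_treeSpan {n : ℕ} (T : RootedTree n) : P.evalTree μ T ∈ P.treeSpan μ n :=
  Submodule.subset_span ⟨T, rfl⟩

lemma act_mem_treeSpan (hμ : IsNAP P μ) {n : ℕ} (σ : Equiv.Perm (Fin n)) {x : P.obj n}
    (hx : x ∈ P.treeSpan μ n) : P.act σ x ∈ P.treeSpan μ n := by
  suffices P.treeSpan μ n ≤ (P.treeSpan μ n).comap (P.act σ) from this hx
  refine Submodule.span_le.2 ?_
  rintro _ ⟨T, rfl⟩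
  rw [SetLike.mem_coe, Submodule.mem_comap, ← evalTree_relabel hμ]
  exact evalTree_mem_treeSpan _

lemma graft_mem_treeSpan (hμ : IsNAP P μ) {n : ℕ} (i : Fin n) {x : P.obj n}
    (hx : x ∈ P.treeSpan μ n) : P.graft μ i x ∈ P.treeSpan μ (n + 1) := by
  suffices P.treeSpan μ n ≤ (P.treeSpan μ (n + 1)).comap (P.graft μ i) from this hx
  refine Submodule.span_le.2 ?_
  rintro _ ⟨T, rfl⟩
  rw [SetLike.mem_coe, Submodule.mem_comap, ← evalTree_graft hμ]
  exact evalTree_mem_treeSpan _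

/-- Induction on the number of vertices of `S`, removing a leaf: up to renumbering, `x ∘_i (y ∘_j μ)
= (x ∘_i y) ∘ μ`, where the new `μ` is inserted at the input `j` of `y`. The inner composite lies in
the span by induction, and the outer one is a graft. -/
lemma comp_evalTree_mem_treeSpan (hμ : IsNAP P μ) {m : ℕ} (S : RootedTree m) :
    ∀ {n k : ℕ} (h : k + 1 = n + m) (i : Fin n) {x : P.obj n}, x ∈ P.treeSpan μ n →
      P.comp h i x (P.evalTree μ S) ∈ P.treeSpan μ k := by
  induction m with
  | zero => exact S.root.elim0
  | succ m ih =>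
    intro n k h i x hx
    cases m with
    | zero =>
      obtain rfl : k = n := by omega
      rwa [evalTree_one, P.comp_one]
    | succ m =>
      obtain ⟨S', j, σ, -, hS⟩ := P.exists_evalTree_eq μ S
      -- The renumbering in `graft` and the relabeling `σ` are pulled out together, leaving the
      -- plain composite to which associativity applies.
      have e := P.comp_act h i 1 (graftPerm j * σ) x
        (P.comp (m := 2) rfl j (P.evalTree μ S') μ)
      rw [P.act_one, Equiv.Perm.one_apply] at e
      obtain rfl : k = n + m + 1 := by omega
      rw [hS, graft_apply, ← P.act_mul, e,
        ← P.comp_assoc (n := n) (m := m + 1) (l := 2) (a := n + m) (by omega) rfl rfl h i j,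
        comp_eq_act_graft]
      exact act_mem_treeSpan hμ _ (act_mem_treeSpan hμ _
        (graft_mem_treeSpan hμ _ (ih S' _ i hx)))

lemma comp_mem_treeSpan (hμ : IsNAP P μ) {n m k : ℕ} (h : k + 1 = n + m) (i : Fin n)
    {x : P.obj n} {y : P.obj m} (hx : x ∈ P.treeSpan μ n) (hy : y ∈ P.treeSpan μ m) :
    P.comp h i x y ∈ P.treeSpan μ k := by
  suffices P.treeSpan μ m ≤ (P.treeSpan μ k).comap (P.comp h i x) from this hy
  refine Submodule.span_le.2 ?_
  rintro _ ⟨S, rfl⟩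
  exact comp_evalTree_mem_treeSpan hμ S h i hx

lemma one_mem_treeSpan : P.one ∈ P.treeSpan μ 1 := by
  rw [← evalTree_one P μ RootedTree.single]
  exact evalTree_mem_treeSpan _

/-- By the unit axiom `μ` is `id ∘_0 μ`, hence a renumbered graft of the unit. -/
lemma mem_treeSpan (hμ : IsNAP P μ) : μ ∈ P.treeSpan μ 2 := by
  have h := act_mem_treeSpan hμ (graftPerm 0)⁻¹ (graft_mem_treeSpan hμ 0 one_mem_treeSpan)
  rwa [← comp_eq_act_graft, P.one_comp] at h

end EvalTree

/-! ### Morphisms -/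

lemma Hom.map_graft {P Q : Operad K} (F : Hom P Q) (μ : P.obj 2) {n : ℕ} (i : Fin n)
    (p : P.obj n) : F.map _ (P.graft μ i p) = Q.graft (F.map 2 μ) i (F.map n p) := by
  rw [graft_apply, graft_apply, F.map_act, F.map_comp]

/-- A morphism to the operad of rooted trees that sends `μ` to the tree with two vertices sends the
evaluation of a tree to this tree. -/
lemma Hom.map_evalTree {P : Operad K} {μ : P.obj 2} (F : Hom P (treeOperad K))
    (hF : F.map 2 μ = treeMonomial K RootedTree.edge) {n : ℕ} (T : RootedTree n) :
    F.map n (P.evalTree μ T) = treeMonomial K T := by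
  induction n with
  | zero => exact T.root.elim0
  | succ n ih =>
    cases n with
    | zero =>
      rw [evalTree_one, F.map_one, RootedTree.eq_single T]
      rfl
    | succ n =>
      obtain ⟨T', i, σ, h, h'⟩ := P.exists_evalTree_eq μ T
      rw [h', F.map_act, F.map_graft, hF, ih, graft_treeMonomial, act_treeMonomial, h]

/-- If the operations given by trees span the operad, such a morphism is bijective. -/
lemma Hom.bijective_of_treeSpan_eq_top {P : Operad K} {μ : P.obj 2} (F : Hom P (treeOperad K))
    (hF : F.map 2 μ = treeMonomial K RootedTree.edge) (n : ℕ) (h : P.treeSpan μ n = ⊤) :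
    Function.Bijective (F.map n) := by
  let G : (treeOperad K).obj n →ₗ[K] P.obj n :=
    Finsupp.linearCombination K fun T : RootedTree n => P.evalTree μ T
  have hG : ∀ T : RootedTree n, G (treeMonomial K T) = P.evalTree μ T := fun T =>
    (Finsupp.linearCombination_single K 1 T).trans (one_smul K _)
  have hFG : ∀ y, F.map n (G y) = y := by
    intro y
    suffices F.map n ∘ₗ G = LinearMap.id from LinearMap.congr_fun this y
    refine Finsupp.lhom_ext' fun T => LinearMap.ext_ring ?_
    change F.map n (G (treeMonomial K T)) = treeMonomial K T
    rw [hG, F.map_evalTree hF]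
  have hsurj : Function.Surjective G := by
    rw [← LinearMap.range_eq_top, ← top_le_iff, ← h]
    refine Submodule.span_le.2 ?_
    rintro _ ⟨T, rfl⟩
    exact ⟨_, hG T⟩
  -- Since `G` is surjective, injectivity of `F` need only be tested on values of `G`, where `F`
  -- undoes `G`.
  refine ⟨fun x y hxy => ?_, fun y => ⟨G y, hFG y⟩⟩
  obtain ⟨x, rfl⟩ := hsurj x
  obtain ⟨y, rfl⟩ := hsurj y
  rw [hFG, hFG] at hxy
  rw [hxy]

/-- A morphism of operads that is bijective in each arity is an isomorphism. -/
def Iso.ofBijective {P Q : Operad K} (F : Hom P Q) (hF : ∀ n, Function.Bijective (F.map n)) :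
    Iso P Q where
  hom := F
  inv :=
    { map := fun n => (LinearEquiv.ofBijective (F.map n) (hF n)).symm
      map_act := fun σ x => (hF _).1 <| by
        obtain ⟨x, rfl⟩ := (hF _).2 x
        rw [← F.map_act]
        simp only [LinearEquiv.coe_coe, LinearEquiv.ofBijective_symm_apply_apply]
      map_one := by
        rw [← F.map_one]
        exact LinearEquiv.ofBijective_symm_apply_apply _ _
      map_comp := fun h i p q => by
        obtain ⟨p, rfl⟩ := (hF _).2 p
        obtain ⟨q, rfl⟩ := (hF _).2 q
        rw [← F.map_comp]
        simp only [LinearEquiv.coe_coe, LinearEquiv.ofBijective_symm_apply_apply] }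
  inv_hom n p := LinearEquiv.ofBijective_symm_apply_apply _ _
  hom_inv n q := LinearEquiv.apply_ofBijective_symm_apply _ _

/-- The kernel of a morphism of operads. -/
def Hom.ker {P Q : Operad K} (F : Hom P Q) : Ideal P where
  carrier n := LinearMap.ker (F.map n)
  act_mem σ x hx := by
    rw [LinearMap.mem_ker] at hx ⊢
    rw [F.map_act, hx, map_zero]
  comp_mem_left h i p q hp := by
    rw [LinearMap.mem_ker] at hp ⊢
    rw [F.map_comp, hp, map_zero, LinearMap.zero_apply]
  comp_mem_right h i p q hq := by
    rw [LinearMap.mem_ker] at hq ⊢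
    rw [F.map_comp, hq, map_zero]

/-- The morphism on a quotient induced by a morphism that vanishes on the ideal. -/
def Hom.quotientLift {P Q : Operad K} (F : Hom P Q) (I : Ideal P)
    (hI : ∀ n, I.carrier n ≤ F.ker.carrier n) : Hom (P.quotient I) Q where
  map n := (I.carrier n).liftQ (F.map n) (hI n)
  map_act σ x := by
    induction x using Submodule.Quotient.induction_on
    exact F.map_act _ _
  map_one := F.map_one
  map_comp h i p q := by
    induction p using Submodule.Quotient.induction_on
    induction q using Submodule.Quotient.induction_on
    exact F.map_comp _ _ _ _

lemma Ideal.span_le {P : Operad K} {d : ℕ} {R : Set (P.obj d)} {I : Ideal P}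
    (h : R ⊆ I.carrier d) (n : ℕ) : (Ideal.span P R).carrier n ≤ I.carrier n :=
  iInf₂_le I h

lemma Ideal.subset_span {P : Operad K} {d : ℕ} (R : Set (P.obj d)) :
    R ⊆ (Ideal.span P R).carrier d := fun x hx => by
  change x ∈ (⨅ (I : Ideal P) (_ : R ⊆ I.carrier d), I.carrier d : Submodule K _)
  simp only [Submodule.mem_iInf]
  exact fun I hI => hI hx

end Operad

/-! ### Generation of the free binary operad and morphisms out of it -/

section Free

variable {K : Type u} [Field K]

/-- A family of subspaces of the free operad that is closed under the operations and contains the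
generators is everything. -/
lemma freeOperad.mem_of_closed {M : SigmaModule K}
    (V : ∀ n, Submodule K ((freeOperad M).obj n))
    (hgen : ∀ n (x : M.obj n), (freeOperad.ι M).map n x ∈ V n)
    (hone : (freeOperad M).one ∈ V 1)
    (hact : ∀ {n : ℕ} (σ : Equiv.Perm (Fin n)) {x : (freeOperad M).obj n}, x ∈ V n →
      (freeOperad M).act σ x ∈ V n)
    (hcomp : ∀ {n m k : ℕ} (h : k + 1 = n + m) (i : Fin n) {x : (freeOperad M).obj n}
      {y : (freeOperad M).obj m}, x ∈ V n → y ∈ V m → (freeOperad M).comp h i x y ∈ V k)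
    {n : ℕ} (x : (freeOperad M).obj n) : x ∈ V n := by
  induction x using FreeObj.ind with
  | h p =>
    induction p with
    | gen x => exact hgen _ x
    | one => exact hone
    | act σ p ih => exact hact σ ih
    | comp h i p q ih ih' => exact hcomp h i ih ih'
    | zero => exact (V _).zero_mem
    | add p q ih ih' => exact (V _).add_mem ih ih'
    | smul c p ih => exact (V _).smul_mem c ih

/-- The morphism of `Σ`-modules from the regular representation in arity `d` that is determined by
the image of the unit. -/
def concentratedLift (M : SigmaModule K) {d : ℕ} (x : M.obj d) :
    SigmaModule.Hom ((regularModule K).concentrated d) M where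
  map n :=
    { toFun := fun a => if h : n = d then
          ∑ σ : Equiv.Perm (Fin n), (a ⟨h⟩ : MonoidAlgebra K _).coeff σ • M.act σ (h ▸ x)
        else 0
      map_add' := fun a b => by
        split_ifs with h
        · rw [← Finset.sum_add_distrib]
          exact Finset.sum_congr rfl fun σ _ => add_smul _ _ _
        · rw [add_zero]
      map_smul' := fun c a => by
        split_ifs with h
        · rw [Finset.smul_sum]
          exact Finset.sum_congr rfl fun σ _ => mul_smul _ _ _
        · rw [smul_zero] }
  map_act {n} τ a := by
    change dite _ _ _ = M.act τ (dite _ _ _)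
    split_ifs with h
    · subst h
      rw [map_sum]
      -- Reindexing by `σ ↦ σ * τ`: the coefficient of `a · τ` at `σ * τ` is that of `a` at `σ`.
      refine (Fintype.sum_equiv (Equiv.mulRight τ) _ _ fun σ => ?_).symm
      have e : ((((regularModule K).concentrated n).act τ a ⟨rfl⟩ : MonoidAlgebra K _)).coeff
          (σ * τ) = (a ⟨rfl⟩ : MonoidAlgebra K _).coeff σ := by
        change ((show MonoidAlgebra K (Equiv.Perm (Fin n)) from a ⟨rfl⟩) *
          MonoidAlgebra.of K _ τ).coeff (σ * τ) = _
        rw [MonoidAlgebra.of_apply]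
        exact (MonoidAlgebra.coeff_mul_single_eq_coeff_mul σ
          fun _ _ => mul_left_inj τ).trans (mul_one _)
      rw [map_smul, Equiv.coe_mulRight, e, M.act_mul]
    · rw [map_zero]

lemma concentratedLift_one (M : SigmaModule K) {d : ℕ} (x : M.obj d) :
    (concentratedLift M x).map d (fun _ => (1 : MonoidAlgebra K (Equiv.Perm (Fin d)))) = x := by
  change dite _ _ _ = _
  rw [dif_pos rfl, Finset.sum_eq_single 1]
  · simp [M.act_one, MonoidAlgebra.one_def]
  · intro σ _ hσ
    simp [MonoidAlgebra.one_def, hσ]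
  · simp

/-- The binary generator generates `Free(K[Σ_2])`. -/
lemma binaryFreeOperad_mem_of_closed
    (V : ∀ n, Submodule K ((binaryFreeOperad K).obj n))
    (hgen : binaryGen K ∈ V 2)
    (hone : (binaryFreeOperad K).one ∈ V 1)
    (hact : ∀ {n : ℕ} (σ : Equiv.Perm (Fin n)) {x : (binaryFreeOperad K).obj n}, x ∈ V n →
      (binaryFreeOperad K).act σ x ∈ V n)
    (hcomp : ∀ {n m k : ℕ} (h : k + 1 = n + m) (i : Fin n) {x : (binaryFreeOperad K).obj n}
      {y : (binaryFreeOperad K).obj m}, x ∈ V n → y ∈ V m →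
        (binaryFreeOperad K).comp h i x y ∈ V k)
    {n : ℕ} (x : (binaryFreeOperad K).obj n) : x ∈ V n := by
  refine freeOperad.mem_of_closed V (fun n a => ?_) hone hact hcomp x
  by_cases hn : n = 2
  · subst hn
    -- Group elements span `K[Σ_2]`, and `f` sends `σ` to `μ · σ`, so stability under the action and
    -- under linear combinations covers all generators of arity `2`.
    let f : MonoidAlgebra K (Equiv.Perm (Fin 2)) →ₗ[K] (binaryFreeOperad K).obj 2 :=
      (freeOperad.ι ((regularModule K).concentrated 2)).map 2 ∘ₗ
        (LinearMap.pi fun _ => LinearMap.id :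
          _ →ₗ[K] PLift (2 = 2) → MonoidAlgebra K (Equiv.Perm (Fin 2)))
    have hf : ∀ σ, f (MonoidAlgebra.of K _ σ) = (binaryFreeOperad K).act σ (binaryGen K) := by
      intro σ
      refine Eq.trans ?_ ((freeOperad.ι ((regularModule K).concentrated 2)).map_act σ _)
      exact congrArg ((freeOperad.ι ((regularModule K).concentrated 2)).map 2)
        (funext fun _ => (one_mul (MonoidAlgebra.of K _ σ)).symm)
    suffices ∀ b, f b ∈ V 2 from this (a ⟨rfl⟩)
    intro b
    induction b using MonoidAlgebra.induction_on with
    | of σ => exact hf σ ▸ hact σ hgen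
    | add p q hp hq => exact (map_add f p q) ▸ (V 2).add_mem hp hq
    | smul c p hp => exact (map_smul f c p) ▸ (V 2).smul_mem c hp
  · obtain rfl : a = 0 := funext fun h => absurd h.down hn
    rw [map_zero]
    exact (V n).zero_mem

end Free

/-! ### Comparison of the presented operad with trees -/

section NAP

variable {K : Type u} [Field K]

lemma isNAP_napMul : Operad.IsNAP (napOperad K) (napMul K) := by
  have h : napRelator K ∈ (napIdeal K).carrier 3 :=
    Operad.Ideal.subset_span _ (Submodule.subset_span
      ⟨1, (binaryFreeOperad K).act_one (napRelator K)⟩)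
  exact (Submodule.Quotient.eq _).2 h

/-- The preimage of the tree span in the free operad is closed under all operations and contains the
unit and the generator, so it is the whole free operad. -/
lemma treeSpan_napMul_eq_top (n : ℕ) : (napOperad K).treeSpan (napMul K) n = ⊤ := by
  refine (Submodule.eq_top_iff').2 fun x => ?_
  induction x using Submodule.Quotient.induction_on with
  | H y =>
    exact binaryFreeOperad_mem_of_closed
      (fun n => ((napOperad K).treeSpan (napMul K) n).comap ((napIdeal K).carrier n).mkQ)
      (Operad.mem_treeSpan isNAP_napMul) Operad.one_mem_treeSpan
      (fun σ _ hx => Operad.act_mem_treeSpan isNAP_napMul σ hx)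
      (fun h i _ _ hx hy => Operad.comp_mem_treeSpan isNAP_napMul h i hx hy) y

lemma exists_hom_napOperad {Q : Operad K} {ν : Q.obj 2} (hν : Operad.IsNAP Q ν) :
    ∃ F : Operad.Hom (napOperad K) Q, F.map 2 (napMul K) = ν := by
  obtain ⟨F, hF, -⟩ := freeOperad.existsUnique_hom _ Q (concentratedLift Q.toSigmaModule ν)
  have hgen : F.map 2 (binaryGen K) = ν := (hF 2 _).trans (concentratedLift_one _ ν)
  have hker : ∀ n, (napIdeal K).carrier n ≤ F.ker.carrier n := by
    -- The kernel is an ideal, so it suffices that it contains the relations; being stable under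
    -- `Σ_3`, it need only contain the single relator.
    refine Operad.Ideal.span_le ?_
    refine Submodule.span_le.2 ?_
    rintro _ ⟨σ, rfl⟩
    refine F.ker.act_mem σ ?_
    change F.map 3 (napRelator K) = 0
    have hc := F.map_comp (n := 2) (m := 2) (k := 3) rfl 0 (binaryGen K) (binaryGen K)
    have ha := F.map_act (Equiv.swap 1 2)
      ((binaryFreeOperad K).comp (n := 2) (m := 2) (k := 3) rfl 0 (binaryGen K) (binaryGen K))
    refine (map_sub (F.map 3) _ _).trans (sub_eq_zero.2 ?_)
    refine hc.trans (Eq.trans ?_ ha.symm)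
    refine Eq.trans ?_ (congrArg _ hc.symm)
    rw [hgen]
    exact hν
  exact ⟨F.quotientLift (napIdeal K) hker, hgen⟩

/-- There is no tree without vertices, since it would lack a root, and exactly one tree with one
vertex. -/
lemma treeOperad_isNormalized : (treeOperad K).IsNormalized := by
  refine ⟨inferInstanceAs (Subsingleton (RootedTree 0 →₀ K)), ?_⟩
  have e : (fun c : K => c • (treeOperad K).one) =
      ((Finsupp.uniqueEquiv RootedTree.single).symm : K → RootedTree 1 →₀ K) := by
    funext c
    refine (Finsupp.smul_single c RootedTree.single (1 : K)).trans ?_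
    rw [smul_eq_mul, mul_one, Finsupp.uniqueEquiv_symm_apply]
  rw [e]
  exact Equiv.bijective _

/-- The normalization of the presented operad is not visible from generators and relations; it is
transported from trees along the isomorphism. -/
lemma Operad.Iso.isNormalized {P Q : Operad K} (Φ : Operad.Iso P Q) (hQ : Q.IsNormalized) :
    P.IsNormalized := by
  have := hQ.1
  refine ⟨(Function.LeftInverse.injective (Φ.inv_hom 0)).subsingleton, ?_⟩
  have e : (fun c : K => c • P.one) = Φ.inv.map 1 ∘ fun c : K => c • Q.one := by
    funext c
    rw [Function.comp_apply, map_smul, Φ.inv.map_one]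
  rw [e]
  exact Function.Bijective.comp
    ⟨Function.LeftInverse.injective (Φ.hom_inv 1), Function.LeftInverse.surjective (Φ.inv_hom 1)⟩
    hQ.2

end NAP

end SymOperad

end

theorem proposition2p3 (K : Type u) [Field K] [CharZero K] :
    (SymOperad.treeOperad K).IsNormalized ∧ (SymOperad.napOperad K).IsNormalized ∧
      ∃ Φ : SymOperad.Operad.Iso (SymOperad.napOperad K) (SymOperad.treeOperad K),
        Φ.hom.map 2 (SymOperad.napMul K) = Finsupp.single SymOperad.RootedTree.edge 1 := by
  obtain ⟨F, hF⟩ := SymOperad.exists_hom_napOperad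
    (SymOperad.isNAP_treeMonomial_edge (K := K))
  let Φ := SymOperad.Operad.Iso.ofBijective F fun n =>
    F.bijective_of_treeSpan_eq_top hF n (SymOperad.treeSpan_napMul_eq_top n)
  exact ⟨SymOperad.treeOperad_isNormalized, Φ.isNormalized SymOperad.treeOperad_isNormalized,
    Φ, hF⟩
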